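/- Let $n\ge 0$ and regard the complex $n\times n$ matrices as a real vector space of dimension $2n^2$ with the Euclidean norm. Submanifolds are smooth and embedded; $\dim_H$ is Hausdorff dimension. (0) The set $U(n)$ of unitary $n\times n$ matrices is a submanifold of real dimension $n^2$, and $\dim_H U(n)=n^2$. (1) Let $k_1,\dots,k_I\ge 1$ be integers with $k_1+\cdots+k_I=n$. The set of unitary $n\times n$ matrices having exactly $I$ distinct eigenvalues, with multiplicities $k_1,\dots,k_I$, is nonempty and is a submanifold of real dimension $n^2-\sum_{i=1}^I(k_i^2-1)$; it is a submanifold of $U(n)$ of real codimension $\sum_{i=1}^I(k_i^2-1)$. Its Hausdorff dimension is also $n^2-\sum_{i=1}^I(k_i^2-1)$. (2) Let $1\le k\le n$. The set of unitary $n\times n$ matrices having one eigenvalue of multiplicity $k$ and $n-k$ further distinct eigenvalues that are all simple is nonempty and is a submanifold of $U(n)$ of real codimension $k^2-1$. The set of all unitary $n\times n$ matrices having an eigenvalue of multiplicity exactly $k$ (the multiplicities of the other eigenvalues being arbitrary) has Hausdorff dimension $n^2-(k^2-1)$, that is, codimension $k^2-1$ in $U(n)$. -/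

import Mathlib

open scoped ContDiff Matrix.Norms.Frobenius

section Submanifolds

variable {E : Type*} [NormedAddCommGroup E] [NormedSpace ℝ E] [FiniteDimensional ℝ E]

/-- A smooth local coordinate system of the real vector space `E`: a homeomorphism between
two open subsets of `E` that is smooth with smooth inverse. -/
def IsSmoothChart (φ : OpenPartialHomeomorph E E) : Prop :=
  ContDiffOn ℝ ∞ φ φ.source ∧ ContDiffOn ℝ ∞ φ.symm φ.target

/-- In the coordinates `φ`, the set `S` is the part of the linear subspace `W` that lies in
the range of the coordinates. -/
def IsSliceOn (φ : OpenPartialHomeomorph E E) (S : Set E) (W : Submodule ℝ E) : Prop :=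
  ∀ y ∈ φ.source, y ∈ S ↔ φ y ∈ W

/-- `S` is a smooth (embedded) submanifold of `E` of real dimension `d`: around each of its
points there are smooth coordinates of `E` in which `S` is a `d`-dimensional linear subspace. -/
def IsSubmanifoldOfDim (S : Set E) (d : ℤ) : Prop :=
  ∀ x ∈ S, ∃ (φ : OpenPartialHomeomorph E E) (W : Submodule ℝ E),
    x ∈ φ.source ∧ IsSmoothChart φ ∧ IsSliceOn φ S W ∧ (Module.finrank ℝ W : ℤ) = d

/-- `S` is a smooth (embedded) submanifold of `M` of real codimension `c`: it is a subset of `M`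
and around each of its points there are smooth coordinates of `E` in which `M` is a linear
subspace `V` and `S` is a linear subspace `W ≤ V` with `dim V - dim W = c`. In other words,
`S` is given inside `M` by `c` independent real conditions. -/
def IsSubmanifoldOfCodimIn (S M : Set E) (c : ℤ) : Prop :=
  S ⊆ M ∧ ∀ x ∈ S, ∃ (φ : OpenPartialHomeomorph E E) (V W : Submodule ℝ E),
    x ∈ φ.source ∧ IsSmoothChart φ ∧ IsSliceOn φ M V ∧ IsSliceOn φ S W ∧ W ≤ V ∧
      (Module.finrank ℝ V : ℤ) - (Module.finrank ℝ W : ℤ) = c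

end Submanifolds

/-- The set of unitary `n × n` matrices, inside the real vector space of complex matrices
(with the Euclidean norm of the entries). -/
def unitarySet (n : ℕ) : Set (Matrix (Fin n) (Fin n) ℂ) :=
  {A | A ∈ Matrix.unitaryGroup (Fin n) ℂ}

/-- The matrix `A` has exactly `I` distinct eigenvalues, which can be listed as `ev 0, …` so that
`ev i` has multiplicity `k i`. -/
def HasMultiplicities {n I : ℕ} (A : Matrix (Fin n) (Fin n) ℂ) (k : Fin I → ℕ) : Prop :=
  ∃ ev : Fin I → ℂ, Function.Injective ev ∧ spectrum ℂ A = Set.range ev ∧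
    ∀ i, A.charpoly.rootMultiplicity (ev i) = k i

/-- The unitary matrices of order `n` with eigenvalue multiplicities `k 0, k 1, …`. -/
def unitaryWithMult (n : ℕ) {I : ℕ} (k : Fin I → ℕ) : Set (Matrix (Fin n) (Fin n) ℂ) :=
  {A | A ∈ unitarySet n ∧ HasMultiplicities A k}

/-- The unitary matrices of order `n` that have an eigenvalue of multiplicity `k` (the other
eigenvalues being arbitrary). -/
def unitaryWithFoldEigenvalue (n k : ℕ) : Set (Matrix (Fin n) (Fin n) ℂ) :=
  {A | A ∈ unitarySet n ∧ ∃ μ ∈ spectrum ℂ A, A.charpoly.rootMultiplicity μ = k}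

/-!
Smoothness, dimension and codimension are all read off from one explicit parametrization
of the matrices near a given unitary matrix `A`, and Hausdorff dimensions follow from smoothness.

Diagonalize `A = W₀ Λ W₀ᴴ` with `Λ = diag (ν (b 0), ν (b 1), …)`, where `ν` lists the distinct
eigenvalues and `b` tells which of them stands at each place, so that the multiplicities are the
cardinalities of the fibres of `b`. Split a small matrix `Z` into its skew-Hermitian part `X + D`,
with `D` the diagonal blocks (with respect to `b`) and `X` the rest, and its Hermitian part `P`.
With the Cayley transform `c`, which maps skew-Hermitian matrices to unitary ones, put
`F Z = c(X) (Λ c(D)) c(X)ᴴ (1 + P)` (`unitaryParam`). Its derivative at `0` is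
`Z ↦ 2 (X Λ - Λ X) + Λ (2 D + P)`, which is injective because the `ν i` are distinct and of absolute
value `1`. By the inverse function theorem the inverse of `W₀ F W₀ᴴ` is a chart around `A`
(`exists_isSmoothChart_of_contDiffAt`).

Near `0`, the matrix `F Z` is unitary iff `1 + P` is, that is iff `P = 0`, so `U(n)` becomes the
space of skew-Hermitian matrices, of real dimension `n²`. If `P = 0` then `F Z` is conjugate to
`Λ c(D)`, which is block diagonal and close to `Λ`: its `i`-th block has an eigenvalue close to
`ν i`, so it has at least as many distinct eigenvalues as `A`, with equality iff each block is a
scalar (`hasMultiplicities_iff_of_norm_sub_lt`), that is iff each block of `D` is a scalar. Hence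
matrices with the multiplicities of `A` become the subspace `skewScalarBlocks b`, in which a
skew-Hermitian `k i × k i` block, of dimension `(k i)²`, is replaced by an imaginary scalar, of
dimension `1`. The charts are collected in `exists_adapted_chart`.

A nonempty `d`-dimensional submanifold has Hausdorff dimension `d`, since charts are locally
bi-Lipschitz (`IsSubmanifoldOfDim.dimH_eq`). The unitary matrices with a `k`-fold eigenvalue are a
countable union of sets of prescribed multiplicities one of which is `k`; the largest of these
sets has multiplicities `(k, 1, …, 1)`.
-/

/-! ### Smooth charts and the Hausdorff dimension of submanifolds -/

section General

open Topology Set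

variable {E : Type*} [NormedAddCommGroup E] [NormedSpace ℝ E] [FiniteDimensional ℝ E]

/-- The inverse function theorem, as a source of charts: a map that is analytic at `x` and has an
injective derivative there has a smooth local inverse around `F x`, and its values can be taken to
satisfy any property that holds near `x`. -/
theorem exists_isSmoothChart_of_contDiffAt {F : E → E} {x : E} (hF : ContDiffAt ℝ ω F x)
    {F' : E →L[ℝ] E} (hF' : HasFDerivAt F F' x) (hinj : Function.Injective F')
    {p : E → Prop} (hp : ∀ᶠ z in 𝓝 x, p z) :
    ∃ φ : OpenPartialHomeomorph E E, F x ∈ φ.source ∧ IsSmoothChart φ ∧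
      ∀ y ∈ φ.source, F (φ y) = y ∧ p (φ y) := by
  have : CompleteSpace E := FiniteDimensional.complete ℝ E
  let e : E ≃L[ℝ] E := (LinearEquiv.ofInjectiveEndo (F' : E →ₗ[ℝ] E) hinj).toContinuousLinearEquiv
  have he : HasFDerivAt F (e : E →L[ℝ] E) x := by
    convert hF'
    ext; rfl
  have hω : (ω : WithTop ℕ∞) ≠ 0 := by simp
  let Φ := hF.toOpenPartialHomeomorph F he hω
  have hΦ : ∀ z, Φ z = F z := fun z => rfl
  have hxΦ : x ∈ Φ.source := hF.mem_toOpenPartialHomeomorph_source he hω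
  have hsymm : ContDiffAt ℝ ω Φ.symm (F x) := hF.to_localInverse he hω
  -- Unlike smoothness, analyticity at a point spreads to a neighbourhood, so it is used here.
  have hev : ∀ᶠ z in 𝓝 x, p z ∧ ContDiffAt ℝ ω F z ∧ ContDiffAt ℝ ω Φ.symm (F z) :=
    hp.and ((hF.eventually (by simp)).and
      (hF.continuousAt.eventually (hsymm.eventually (by simp))))
  obtain ⟨s, hs, hso, hxs⟩ := eventually_nhds_iff.1 hev
  refine ⟨(Φ.restrOpen s hso).symm, ?_, ⟨?_, ?_⟩, ?_⟩
  · exact (Φ.restrOpen s hso).map_source (x := x) (by simp [hxΦ, hxs])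
  · intro y hy
    have hz : (Φ.restrOpen s hso).symm y ∈ (Φ.restrOpen s hso).source :=
      (Φ.restrOpen s hso).map_target hy
    have hyz : Φ ((Φ.restrOpen s hso).symm y) = y := (Φ.restrOpen s hso).right_inv hy
    have h2 := (hs ((Φ.restrOpen s hso).symm y) (by simpa using hz.2)).2.2
    rw [← hΦ, hyz] at h2
    exact (h2.of_le le_top).contDiffWithinAt
  · intro z hz
    exact ((hs z (by simpa using hz.2)).2.1.of_le le_top).contDiffWithinAt
  · intro y hy
    have hz : (Φ.restrOpen s hso).symm y ∈ (Φ.restrOpen s hso).source :=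
      (Φ.restrOpen s hso).map_target hy
    exact ⟨(Φ.restrOpen s hso).right_inv hy, (hs _ (by simpa using hz.2)).1⟩

theorem Submodule.dimH_coe (W : Submodule ℝ E) : dimH (W : Set E) = Module.finrank ℝ W := by
  have h : (W : Set E) = ((↑) : W → E) '' univ := by simp
  rw [h, W.subtypeₗᵢ.isometry.dimH_image univ |>.trans (Real.dimH_univ_eq_finrank W) |>.symm]
  rfl

theorem Submodule.dimH_inter_of_mem_nhds (W : Submodule ℝ E) {w : E} (hw : w ∈ W) {t : Set E}
    (ht : t ∈ 𝓝 w) : dimH ((W : Set E) ∩ t) = Module.finrank ℝ W := by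
  have h1 : ((↑) : W → E) ⁻¹' t ∈ 𝓝 (⟨w, hw⟩ : W) := continuous_subtype_val.continuousAt ht
  rw [← Real.dimH_of_mem_nhds h1, ← W.subtypeₗᵢ.isometry.dimH_image]
  congr 1
  ext y
  simp [and_comm]

theorem IsSmoothChart.dimH_image_le {φ : OpenPartialHomeomorph E E} (hφ : IsSmoothChart φ)
    {x : E} {r : ℝ} (hr : Metric.ball x r ⊆ φ.source) {t : Set E} (ht : t ⊆ Metric.ball x r) :
    dimH (φ '' t) ≤ dimH t :=
  ((hφ.1.mono hr).of_le (by simp)).dimH_image_le (convex_ball x r) ht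

/-- Charts are locally bi-Lipschitz, so a submanifold has the Hausdorff dimension of the subspaces
that it is modelled on. -/
theorem IsSubmanifoldOfDim.dimH_eq {S : Set E} {d : ℕ} (hS : IsSubmanifoldOfDim S d)
    (hne : S.Nonempty) : dimH S = d := by
  apply le_antisymm
  · by_contra! hlt
    obtain ⟨x, hx, hxt⟩ := exists_mem_nhdsWithin_lt_dimH_of_lt_dimH hlt
    obtain ⟨φ, W, hxφ, hφ, hslice, hd⟩ := hS x hx
    obtain ⟨r, hr, hball⟩ := Metric.isOpen_iff.1 φ.open_target _ (φ.map_source hxφ)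
    have hpre : φ ⁻¹' Metric.ball (φ x) r ∈ 𝓝 x :=
      (φ.continuousAt hxφ) (Metric.ball_mem_nhds _ hr)
    have ht : S ∩ (φ.source ∩ φ ⁻¹' Metric.ball (φ x) r) ∈ 𝓝[S] x :=
      inter_mem_nhdsWithin S (Filter.inter_mem (φ.open_source.mem_nhds hxφ) hpre)
    refine absurd (hxt _ ht) (not_lt.2 ?_)
    calc dimH (S ∩ (φ.source ∩ φ ⁻¹' Metric.ball (φ x) r))
        ≤ dimH (φ.symm '' ((W : Set E) ∩ Metric.ball (φ x) r)) := by
          refine dimH_mono ?_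
          rintro y ⟨hyS, hys, hyb⟩
          exact ⟨φ y, ⟨(hslice y hys).1 hyS, hyb⟩, φ.left_inv hys⟩
      _ ≤ dimH ((W : Set E) ∩ Metric.ball (φ x) r) :=
          IsSmoothChart.dimH_image_le (φ := φ.symm) ⟨hφ.2, hφ.1⟩ hball inter_subset_right
      _ ≤ dimH (W : Set E) := dimH_mono inter_subset_left
      _ = d := by rw [W.dimH_coe, Int.natCast_inj.1 hd]
  · obtain ⟨x, hx⟩ := hne
    obtain ⟨φ, W, hxφ, hφ, hslice, hd⟩ := hS x hx
    obtain ⟨r, hr, hball⟩ := Metric.isOpen_iff.1 φ.open_source _ hxφ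
    have hxt : φ x ∈ φ.target := φ.map_source hxφ
    have hpre : φ.target ∩ φ.symm ⁻¹' Metric.ball x r ∈ 𝓝 (φ x) := by
      refine Filter.inter_mem (φ.open_target.mem_nhds hxt) ((φ.symm.continuousAt hxt) ?_)
      rw [φ.left_inv hxφ]
      exact Metric.ball_mem_nhds _ hr
    have hWx : φ x ∈ W := (hslice x hxφ).1 hx
    set t : Set E := (W : Set E) ∩ (φ.target ∩ φ.symm ⁻¹' Metric.ball x r) with ht
    have hdt : dimH t = d := by
      rw [ht, W.dimH_inter_of_mem_nhds hWx hpre, Int.natCast_inj.1 hd]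
    calc (d : ENNReal) = dimH t := hdt.symm
      _ ≤ dimH (φ '' (φ.symm '' t)) := by
          refine dimH_mono ?_
          rintro z hz
          exact ⟨φ.symm z, ⟨z, hz, rfl⟩, φ.right_inv hz.2.1⟩
      _ ≤ dimH (φ.symm '' t) := by
          refine hφ.dimH_image_le hball ?_
          rintro _ ⟨z, hz, rfl⟩
          exact hz.2.2
      _ ≤ dimH S := by
          refine dimH_mono ?_
          rintro _ ⟨z, hz, rfl⟩
          refine (hslice _ (φ.map_target hz.2.1)).2 ?_
          rw [φ.right_inv hz.2.1]
          exact hz.1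

end General

/-! ### Diagonalization of unitary matrices -/

theorem infinite_circle : Infinite Circle := by
  rw [Circle.argEquiv.infinite_iff, Set.infinite_coe_iff]
  exact Set.Ioc_infinite (by linarith [Real.pi_pos])

section Matrices

open Topology Set Matrix

variable {n : ℕ}

theorem mem_unitarySet_iff {A : Matrix (Fin n) (Fin n) ℂ} : A ∈ unitarySet n ↔ Aᴴ * A = 1 :=
  Matrix.mem_unitaryGroup_iff'

theorem mul_mem_unitarySet {A B : Matrix (Fin n) (Fin n) ℂ} (hA : A ∈ unitarySet n)
    (hB : B ∈ unitarySet n) : A * B ∈ unitarySet n :=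
  (Matrix.unitaryGroup (Fin n) ℂ).mul_mem hA hB

theorem conjTranspose_mem_unitarySet {A : Matrix (Fin n) (Fin n) ℂ} (hA : A ∈ unitarySet n) :
    Aᴴ ∈ unitarySet n :=
  Unitary.star_mem hA

theorem conjTranspose_mul_self_of_mem {A : Matrix (Fin n) (Fin n) ℂ} (hA : A ∈ unitarySet n) :
    Aᴴ * A = 1 := mem_unitarySet_iff.1 hA

theorem mul_conjTranspose_self_of_mem {A : Matrix (Fin n) (Fin n) ℂ} (hA : A ∈ unitarySet n) :
    A * Aᴴ = 1 := Matrix.mem_unitaryGroup_iff.1 hA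

theorem diagonal_mem_unitarySet_iff {d : Fin n → ℂ} :
    diagonal d ∈ unitarySet n ↔ ∀ a, ‖d a‖ = 1 := by
  rw [mem_unitarySet_iff, diagonal_conjTranspose, diagonal_mul_diagonal, ← diagonal_one,
    diagonal_injective.eq_iff, funext_iff]
  refine forall_congr' fun a => ?_
  simp only [Pi.star_apply, RCLike.star_def, Complex.conj_mul']
  rw [← Complex.ofReal_pow, Complex.ofReal_eq_one]
  exact pow_eq_one_iff_of_nonneg (norm_nonneg _) two_ne_zero

theorem norm_apply_le_frobenius_norm (A : Matrix (Fin n) (Fin n) ℂ) (a c : Fin n) :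
    ‖A a c‖ ≤ ‖A‖ := by
  rw [Matrix.frobenius_norm_def, ← Real.sqrt_eq_rpow]
  apply Real.le_sqrt_of_sq_le
  simp only [Real.rpow_two]
  calc ‖A a c‖ ^ 2 ≤ ∑ j, ‖A a j‖ ^ 2 :=
        Finset.single_le_sum (f := fun j => ‖A a j‖ ^ 2) (fun _ _ => by positivity)
          (Finset.mem_univ c)
    _ ≤ _ := Finset.single_le_sum (f := fun i => ∑ j, ‖A i j‖ ^ 2)
          (fun _ _ => by positivity) (Finset.mem_univ a)

/-- The spectral theorem for unitary matrices, reduced to that for Hermitian ones: for `z` on the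
unit circle outside the spectrum of `A`, the matrix `H = i (z + A) (z - A)⁻¹` is Hermitian, and a
unitary matrix that diagonalizes `H` also diagonalizes `A = z (H - i) (H + i)⁻¹`. -/
theorem exists_diagonalization_of_mem_unitarySet {A : Matrix (Fin n) (Fin n) ℂ}
    (hA : A ∈ unitarySet n) :
    ∃ W ∈ unitarySet n, ∃ d : Fin n → ℂ, A = W * diagonal d * Wᴴ := by
  have hfin : (spectrum ℂ A).Finite := Matrix.finite_spectrum A
  obtain ⟨z, hz⟩ : ∃ z : Circle, (z : ℂ) ∉ spectrum ℂ A := by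
    by_contra! h
    have := infinite_circle
    refine (Set.infinite_univ (α := Circle)) ?_
    exact (hfin.preimage (f := ((↑) : Circle → ℂ)) Subtype.val_injective.injOn).subset
      fun z _ => h z
  have hzz : star (z : ℂ) * z = 1 := by
    rw [RCLike.star_def, Complex.conj_mul', Circle.norm_coe]; simp
  rw [spectrum.mem_iff, not_not] at hz
  obtain ⟨R, hR⟩ := hz
  rw [Matrix.algebraMap_eq_diagonal] at hR
  have hR' : (R : Matrix (Fin n) (Fin n) ℂ) = (z : ℂ) • (1 : Matrix (Fin n) (Fin n) ℂ) - A := by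
    rw [hR, ← Matrix.diagonal_one, ← Matrix.diagonal_smul]
    congr 2
    ext; simp
  clear hR
  set H : Matrix (Fin n) (Fin n) ℂ :=
    Complex.I • (((z : ℂ) • (1 : Matrix (Fin n) (Fin n) ℂ) + A) * (↑R⁻¹ : Matrix _ _ ℂ)) with hH
  have hHR : H * R = Complex.I • ((z : ℂ) • (1 : Matrix (Fin n) (Fin n) ℂ) + A) := by
    rw [hH, Matrix.smul_mul, Matrix.mul_assoc, Units.inv_mul, mul_one]
  have hAA := conjTranspose_mul_self_of_mem hA
  have hHerm : H.IsHermitian := by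
    have h1 : (R : Matrix (Fin n) (Fin n) ℂ)ᴴ * Hᴴ * R =
        (R : Matrix (Fin n) (Fin n) ℂ)ᴴ * H * R := by
      rw [← conjTranspose_mul, hHR, Matrix.mul_assoc, hHR, hR']
      simp only [conjTranspose_smul, conjTranspose_add, conjTranspose_sub, conjTranspose_one,
        Matrix.smul_mul, Matrix.mul_smul, Matrix.add_mul, Matrix.mul_add, Matrix.mul_sub,
        Matrix.sub_mul, one_mul, mul_one, hAA, smul_add, smul_sub, smul_smul]
      simp only [RCLike.star_def, map_mul, Complex.conj_I]
      rw [RCLike.star_def] at hzz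
      match_scalars
      all_goals first
        | ring1
        | linear_combination -2 * Complex.I * hzz
    have h2 : IsUnit ((R : Matrix (Fin n) (Fin n) ℂ)ᴴ) := by
      have := R.isUnit.star
      exact this
    exact h2.mul_left_cancel (R.isUnit.mul_right_cancel h1)
  set W : Matrix (Fin n) (Fin n) ℂ := hHerm.eigenvectorUnitary.1 with hW
  have hWu : W ∈ unitarySet n := hHerm.eigenvectorUnitary.2
  have hWW := conjTranspose_mul_self_of_mem hWu
  have hWW' := mul_conjTranspose_self_of_mem hWu
  set e : Fin n → ℂ := fun a => (hHerm.eigenvalues a : ℂ) with he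
  have hspec : H = W * diagonal e * Wᴴ := by
    have := hHerm.spectral_theorem
    rw [Unitary.conjStarAlgAut_apply] at this
    exact this
  set B := Wᴴ * A * W with hB
  have hAB : A = W * B * Wᴴ := by
    rw [hB]
    calc A = (W * Wᴴ) * A * (W * Wᴴ) := by rw [hWW']; simp
      _ = _ := by simp only [Matrix.mul_assoc]
  -- The equation `H (z - A) = i (z + A)` in the eigenbasis of `H`.
  have key : diagonal e * ((z : ℂ) • 1 - B) = Complex.I • ((z : ℂ) • 1 + B) := by
    have h3 := congrArg (fun M => Wᴴ * M * W) hHR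
    simp only [hR', hspec] at h3
    have h4 : Wᴴ * (W * diagonal e * Wᴴ * ((z : ℂ) • 1 - A)) * W
        = (Wᴴ * W) * (diagonal e * ((z : ℂ) • (Wᴴ * W) - B)) := by
      rw [hB]
      simp only [Matrix.mul_assoc, Matrix.mul_sub, Matrix.sub_mul, Matrix.mul_smul,
        Matrix.smul_mul, mul_one]
    have h5 : Wᴴ * (Complex.I • ((z : ℂ) • (1 : Matrix (Fin n) (Fin n) ℂ) + A)) * W
        = Complex.I • ((z : ℂ) • (Wᴴ * W) + B) := by
      rw [hB]
      simp only [Matrix.mul_assoc, Matrix.mul_add, Matrix.add_mul, Matrix.mul_smul,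
        Matrix.smul_mul, mul_one]
    rw [h4, h5, hWW, one_mul] at h3
    exact h3
  refine ⟨W, hWu, fun a => (e a - Complex.I) * z / (e a + Complex.I), ?_⟩
  convert hAB
  ext a c
  have hk := congrFun (congrFun key a) c
  rw [diagonal_mul] at hk
  simp only [Matrix.sub_apply, Matrix.smul_apply, Matrix.add_apply, smul_eq_mul] at hk
  have hne : e a + Complex.I ≠ 0 := by
    intro h
    have := congrArg Complex.im h
    simp [he] at this
  have hBac : (e a + Complex.I) * B a c
      = (e a - Complex.I) * z * (1 : Matrix (Fin n) (Fin n) ℂ) a c := by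
    linear_combination -hk
  rw [diagonal_apply]
  split_ifs with hac
  · subst hac
    rw [one_apply_eq, mul_one] at hBac
    rw [← hBac]
    field_simp
  · rw [one_apply_ne hac, mul_zero] at hBac
    exact ((mul_eq_zero.1 hBac).resolve_left hne).symm

theorem hasMultiplicities_conj_iff {W : Matrix (Fin n) (Fin n) ℂ} (hW : W ∈ unitarySet n)
    {A : Matrix (Fin n) (Fin n) ℂ} {I : ℕ} {k : Fin I → ℕ} :
    HasMultiplicities (W * A * Wᴴ) k ↔ HasMultiplicities A k := by
  have hc : (W * A * Wᴴ).charpoly = A.charpoly := by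
    rw [Matrix.charpoly_mul_comm, ← Matrix.mul_assoc, conjTranspose_mul_self_of_mem hW, one_mul]
  have hs : spectrum ℂ (W * A * Wᴴ) = spectrum ℂ A := by
    ext z
    rw [Matrix.mem_spectrum_iff_isRoot_charpoly, Matrix.mem_spectrum_iff_isRoot_charpoly, hc]
  simp only [HasMultiplicities, hc, hs]

theorem conj_mem_unitarySet_iff {W : Matrix (Fin n) (Fin n) ℂ} (hW : W ∈ unitarySet n)
    {A : Matrix (Fin n) (Fin n) ℂ} : W * A * Wᴴ ∈ unitarySet n ↔ A ∈ unitarySet n := by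
  refine ⟨fun h => ?_, fun h => mul_mem_unitarySet (mul_mem_unitarySet hW h)
    (conjTranspose_mem_unitarySet hW)⟩
  have := mul_mem_unitarySet (mul_mem_unitarySet (conjTranspose_mem_unitarySet hW) h) hW
  convert this using 1
  calc A = (Wᴴ * W) * A * (Wᴴ * W) := by simp [conjTranspose_mul_self_of_mem hW]
    _ = _ := by simp only [Matrix.mul_assoc]

theorem rootMultiplicity_charpoly_diagonal (d : Fin n → ℂ) (z : ℂ) :
    (diagonal d).charpoly.rootMultiplicity z = Fintype.card {a // d a = z} := by
  classical
  rw [charpoly_diagonal, ← Polynomial.count_roots,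
    Polynomial.roots_prod _ _ (Finset.prod_ne_zero_iff.2 fun a _ => Polynomial.X_sub_C_ne_zero _)]
  simp only [Polynomial.roots_X_sub_C, Multiset.bind_singleton]
  rw [Multiset.count_map, Fintype.card_subtype]
  simp only [eq_comm]
  rfl

theorem hasMultiplicities_diagonal_comp {I : ℕ} {b : Fin n → Fin I} (hb : Function.Surjective b)
    {ν : Fin I → ℂ} (hν : Function.Injective ν) :
    HasMultiplicities (diagonal fun a => ν (b a)) (fun i => Fintype.card {a // b a = i}) := by
  refine ⟨ν, hν, ?_, fun i => ?_⟩
  · rw [spectrum_diagonal]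
    exact hb.range_comp ν
  · rw [rootMultiplicity_charpoly_diagonal]
    simp only [hν.eq_iff]

end Matrices

/-! ### Eigenvalue multiplicities -/

section Multiplicities

open Topology Set Matrix

variable {n : ℕ}

theorem sum_card_fiber {I : ℕ} (b : Fin n → Fin I) :
    ∑ i, Fintype.card {a // b a = i} = n := by
  rw [← Fintype.card_sigma, Fintype.card_congr (Equiv.sigmaFiberEquiv b), Fintype.card_fin]

/-- The diagonal form of a unitary matrix whose eigenvalues `ν i` have multiplicities `k i`; `b`
assigns to each place of the diagonal the index of the eigenvalue that stands there. -/
theorem exists_diagonalization_of_mem_unitaryWithMult {I : ℕ} {k : Fin I → ℕ}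
    {A : Matrix (Fin n) (Fin n) ℂ} (hA : A ∈ unitaryWithMult n k) :
    ∃ W ∈ unitarySet n, ∃ (b : Fin n → Fin I) (ν : Fin I → ℂ), Function.Surjective b ∧
      Function.Injective ν ∧ (∀ i, ‖ν i‖ = 1) ∧ (∀ i, k i = Fintype.card {a // b a = i}) ∧
      A = W * diagonal (fun a => ν (b a)) * Wᴴ := by
  obtain ⟨hU, hM⟩ := hA
  obtain ⟨W, hW, d, rfl⟩ := exists_diagonalization_of_mem_unitarySet hU
  rw [conj_mem_unitarySet_iff hW, diagonal_mem_unitarySet_iff] at hU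
  rw [hasMultiplicities_conj_iff hW] at hM
  obtain ⟨ν, hν, hs, hm⟩ := hM
  rw [spectrum_diagonal] at hs
  have h1 : ∀ a, ∃ i, ν i = d a := fun a => by
    have : d a ∈ range ν := hs ▸ mem_range_self a
    exact this
  choose b hb using h1
  have h2 : ∀ i, ∃ a, d a = ν i := fun i => by
    have : ν i ∈ range d := hs ▸ mem_range_self i
    exact this
  have hbs : Function.Surjective b := fun i => by
    obtain ⟨a, ha⟩ := h2 i
    exact ⟨a, hν (by rw [hb, ha])⟩
  refine ⟨W, hW, b, ν, hbs, hν, fun i => ?_, fun i => ?_, by simp only [hb]⟩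
  · obtain ⟨a, rfl⟩ := hbs i
    rw [hb]
    exact hU a
  · rw [← hm, rootMultiplicity_charpoly_diagonal]
    simp only [← hb, hν.eq_iff]

theorem exists_mem_unitaryWithMult {A : Matrix (Fin n) (Fin n) ℂ} (hA : A ∈ unitarySet n) :
    ∃ (I : ℕ) (k : Fin I → ℕ), (∀ i, 1 ≤ k i) ∧ ∑ i, k i = n ∧ A ∈ unitaryWithMult n k := by
  classical
  obtain ⟨W, hW, d, rfl⟩ := exists_diagonalization_of_mem_unitarySet hA
  let e := (Finset.univ.image d).equivFin
  let b : Fin n → Fin (Finset.univ.image d).card :=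
    fun a => e ⟨d a, Finset.mem_image_of_mem d (Finset.mem_univ a)⟩
  have hb : Function.Surjective b := fun i => by
    obtain ⟨a, -, ha⟩ := Finset.mem_image.1 (e.symm i).2
    exact ⟨a, by simp [b, ha]⟩
  have hν : Function.Injective fun i => (e.symm i : ℂ) :=
    Subtype.val_injective.comp e.symm.injective
  refine ⟨_, fun i => Fintype.card {a // b a = i}, fun i => ?_, sum_card_fiber b, hA, ?_⟩
  · obtain ⟨a, ha⟩ := hb i
    exact Fintype.card_pos_iff.2 ⟨⟨a, ha⟩⟩
  · rw [hasMultiplicities_conj_iff hW]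
    convert hasMultiplicities_diagonal_comp hb hν with a
    simp [b]

/-- A partition of `n` places into classes of sizes `k i`. -/
theorem exists_card_fiber_eq {I : ℕ} {k : Fin I → ℕ} (hsum : ∑ i, k i = n) :
    ∃ b : Fin n → Fin I, ∀ i, Fintype.card {a // b a = i} = k i := by
  subst hsum
  refine ⟨fun a => (finSigmaFinEquiv.symm a).1, fun i => ?_⟩
  rw [Fintype.card_congr ((finSigmaFinEquiv.symm).subtypeEquiv
    (p := fun a => (finSigmaFinEquiv.symm a).1 = i) (q := fun x => x.1 = i) fun a => Iff.rfl)]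
  rw [Fintype.card_congr (Equiv.sigmaSubtype i), Fintype.card_fin]

theorem unitaryWithMult_nonempty {I : ℕ} {k : Fin I → ℕ} (hk : ∀ i, 1 ≤ k i)
    (hsum : ∑ i, k i = n) : (unitaryWithMult n k).Nonempty := by
  obtain ⟨b, hb⟩ := exists_card_fiber_eq hsum
  have hbs : Function.Surjective b := fun i => by
    have : 0 < Fintype.card {a // b a = i} := by rw [hb]; exact hk i
    obtain ⟨a, ha⟩ := Fintype.card_pos_iff.1 this
    exact ⟨a, ha⟩
  have := infinite_circle
  let z : Fin I → ℂ := fun i => (Infinite.natEmbedding Circle i : Circle)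
  have hz : Function.Injective z := fun i j hij =>
    Fin.ext ((Infinite.natEmbedding Circle).injective (Subtype.val_injective hij))
  refine ⟨diagonal fun a => z (b a), diagonal_mem_unitarySet_iff.2 fun a => Circle.norm_coe _, ?_⟩
  convert hasMultiplicities_diagonal_comp hbs hz using 2 with i
  rw [hb]

theorem exists_pos_two_mul_le_norm_sub {I : ℕ} {ν : Fin I → ℂ} (hν : Function.Injective ν) :
    ∃ ε > 0, ∀ i j, i ≠ j → 2 * ε ≤ ‖ν i - ν j‖ := by
  have h : ∀ᶠ ε : ℝ in 𝓝[>] 0, ∀ i j, i ≠ j → 2 * ε ≤ ‖ν i - ν j‖ := by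
    simp only [Filter.eventually_all]
    intro i j hij
    have h0 : 0 < ‖ν i - ν j‖ / 2 := by
      have := norm_pos_iff.2 (sub_ne_zero.2 (hν.ne hij))
      positivity
    filter_upwards [mem_nhdsWithin_of_mem_nhds (Iio_mem_nhds h0)] with ε hε
    linarith [mem_Iio.1 hε]
  obtain ⟨ε, h1, h2⟩ := (h.and self_mem_nhdsWithin).exists
  exact ⟨ε, h2, h1⟩

/-- Rigidity: a block diagonal unitary matrix close to `diag (ν ∘ b)` which has only as many
distinct eigenvalues as there are blocks is a scalar on each block. Indeed each eigenvector that
does not vanish on a block has an eigenvalue within `ε` of the `ν i` of that block, so there is exactly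
one eigenvalue near each `ν i`, and its eigenvectors live in the `i`-th block. -/
theorem exists_eq_diagonal_of_norm_sub_lt {I : ℕ} {b : Fin n → Fin I}
    (hb : Function.Surjective b) {ν : Fin I → ℂ} {ε : ℝ}
    (hε : ∀ i j, i ≠ j → 2 * ε ≤ ‖ν i - ν j‖) {B : Matrix (Fin n) (Fin n) ℂ}
    (hBU : B ∈ unitarySet n) (hblock : ∀ a c, b a ≠ b c → B a c = 0)
    (hB : ‖B - diagonal fun a => ν (b a)‖ < ε) {k : Fin I → ℕ} (hM : HasMultiplicities B k) :
    ∃ ν' : Fin I → ℂ, B = diagonal fun a => ν' (b a) := by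
  obtain ⟨W, hW, d, hWd⟩ := exists_diagonalization_of_mem_unitarySet hBU
  have hBW : B * W = W * diagonal d := by
    rw [hWd, Matrix.mul_assoc, conjTranspose_mul_self_of_mem hW, mul_one]
  have near : ∀ a c, W a c ≠ 0 → ‖d c - ν (b a)‖ < ε := by
    intro a₀ c hac
    -- `V` has a single nonzero column, the part in the block of `a₀` of the eigenvector `W · c`;
    -- it is again an eigenvector of `B`.
    set V : Matrix (Fin n) (Fin n) ℂ :=
      Matrix.of fun a c' => if b a = b a₀ ∧ c' = c then W a c else 0 with hV
    have hV0 : V ≠ 0 := fun h => hac (by simpa [hV] using congrFun (congrFun h a₀) c)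
    have hBV : (B - diagonal fun a => ν (b a)) * V = (d c - ν (b a₀)) • V := by
      rw [Matrix.sub_mul, sub_smul]
      congr 1
      · ext a c'
        rw [Matrix.mul_apply, Matrix.smul_apply]
        by_cases hc' : c' = c
        · subst hc'
          have h1 := congrFun (congrFun hBW a) c'
          rw [Matrix.mul_apply, mul_diagonal] at h1
          by_cases ha : b a = b a₀
          · simp only [hV, of_apply, ha, and_self, if_true, smul_eq_mul]
            rw [mul_comm, ← h1]
            refine Finset.sum_congr rfl fun x _ => ?_
            by_cases hx : b x = b a₀
            · simp [hx]
            · rw [hblock a x (by rw [ha]; exact fun h => hx h.symm)]; simp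
          · simp only [hV, of_apply, ha, false_and, if_false, smul_zero]
            refine Finset.sum_eq_zero fun x _ => ?_
            by_cases hx : b x = b a₀
            · rw [hblock a x (by rw [hx]; exact ha)]; simp
            · simp [hx]
        · simp [hV, hc']
      · ext a c'
        rw [diagonal_mul, Matrix.smul_apply]
        by_cases ha : b a = b a₀
        · simp [ha]
        · simp [hV, ha]
    have hle : ‖d c - ν (b a₀)‖ * ‖V‖ ≤ ‖B - diagonal fun a => ν (b a)‖ * ‖V‖ := by
      rw [← norm_smul, ← hBV]
      exact norm_mul_le _ _
    exact (le_of_mul_le_mul_right hle (norm_pos_iff.2 hV0)).trans_lt hB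
  have hrow : ∀ a, ∃ c, W a c ≠ 0 := by
    intro a
    by_contra! h
    have := congrFun (congrFun (mul_conjTranspose_self_of_mem hW) a) a
    simp [Matrix.mul_apply, h] at this
  have hsel : ∀ i, ∃ c, ‖d c - ν i‖ < ε := fun i => by
    obtain ⟨a, rfl⟩ := hb i
    obtain ⟨c, hc⟩ := hrow a
    exact ⟨c, near a c hc⟩
  choose c hc using hsel
  have huniq : ∀ (z : ℂ) i j, ‖z - ν i‖ < ε → ‖z - ν j‖ < ε → i = j := by
    intro z i j hi hj
    by_contra hij
    have h1 := hε i j hij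
    have h2 : ‖ν i - ν j‖ ≤ ‖z - ν j‖ + ‖z - ν i‖ := by
      rw [show ν i - ν j = (z - ν j) - (z - ν i) by ring]
      exact norm_sub_le _ _
    linarith
  have hinj : Function.Injective fun i => d (c i) := fun i j hij => by
    refine huniq (d (c i)) i j (hc i) ?_
    simp only at hij
    rw [hij]
    exact hc j
  have hsp : spectrum ℂ B = range d := by
    ext z
    rw [Matrix.mem_spectrum_iff_isRoot_charpoly, hWd, Matrix.charpoly_mul_comm, ← Matrix.mul_assoc,
      conjTranspose_mul_self_of_mem hW, one_mul, ← Matrix.mem_spectrum_iff_isRoot_charpoly,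
      spectrum_diagonal]
  obtain ⟨ev, hev, hs, -⟩ := hM
  -- There are only `I` eigenvalues, so the chosen ones, one for each block, are all of them.
  have hrange : range (fun i => d (c i)) = range d := by
    refine Set.eq_of_subset_of_ncard_le ?_ ?_ (finite_range d)
    · rintro _ ⟨i, rfl⟩
      exact mem_range_self _
    · rw [← hsp, hs, ← image_univ, ← image_univ, ncard_image_of_injective _ hev,
        ncard_image_of_injective _ hinj]
  refine ⟨fun i => d (c i), ?_⟩
  have hDW : (diagonal fun a => d (c (b a))) * W = W * diagonal d := by
    ext a x
    rw [diagonal_mul, mul_diagonal]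
    by_cases h0 : W a x = 0
    · simp [h0]
    · obtain ⟨j, hj⟩ : d x ∈ range fun i => d (c i) := hrange ▸ mem_range_self x
      simp only at hj
      have hjb : j = b a := huniq (d x) j (b a) (hj ▸ hc j) (near a x h0)
      rw [← hjb, hj, mul_comm]
  calc B = B * (W * Wᴴ) := by rw [mul_conjTranspose_self_of_mem hW, mul_one]
    _ = (diagonal fun a => d (c (b a))) * (W * Wᴴ) := by
      rw [← Matrix.mul_assoc, ← Matrix.mul_assoc, hBW, hDW]
    _ = _ := by rw [mul_conjTranspose_self_of_mem hW, mul_one]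

theorem hasMultiplicities_iff_of_norm_sub_lt {I : ℕ} {b : Fin n → Fin I}
    (hb : Function.Surjective b) {ν : Fin I → ℂ} {ε : ℝ}
    (hε : ∀ i j, i ≠ j → 2 * ε ≤ ‖ν i - ν j‖) {B : Matrix (Fin n) (Fin n) ℂ}
    (hBU : B ∈ unitarySet n) (hblock : ∀ a c, b a ≠ b c → B a c = 0)
    (hB : ‖B - diagonal fun a => ν (b a)‖ < ε) :
    HasMultiplicities B (fun i => Fintype.card {a // b a = i}) ↔
      ∃ ν' : Fin I → ℂ, B = diagonal fun a => ν' (b a) := by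
  refine ⟨exists_eq_diagonal_of_norm_sub_lt hb hε hBU hblock hB, ?_⟩
  rintro ⟨ν', rfl⟩
  have hnear : ∀ i, ‖ν' i - ν i‖ < ε := fun i => by
    obtain ⟨a, rfl⟩ := hb i
    refine lt_of_le_of_lt ?_ hB
    simpa using norm_apply_le_frobenius_norm
      ((diagonal fun a => ν' (b a)) - diagonal fun a => ν (b a)) a a
  refine hasMultiplicities_diagonal_comp hb fun i j hij => ?_
  by_contra hne
  have h2 : ‖ν i - ν j‖ ≤ ‖ν' j - ν j‖ + ‖ν' i - ν i‖ := by
    rw [show ν i - ν j = (ν' j - ν j) - (ν' i - ν i) by rw [hij]; ring]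
    exact norm_sub_le _ _
  linarith [hε i j hne, hnear i, hnear j]

end Multiplicities

/-! ### Dimensions of spaces of skew-Hermitian matrices -/

section Subspaces

open Topology Set Matrix

/-- The real vector space of skew-Hermitian matrices. -/
def skewHermitian (m : Type*) : Submodule ℝ (Matrix m m ℂ) where
  carrier := {Z | Zᴴ = -Z}
  add_mem' {Y Z} hY hZ := by
    rw [mem_ofPred_eq] at *
    rw [conjTranspose_add, hY, hZ, neg_add]
  zero_mem' := by simp
  smul_mem' r Z hZ := by
    rw [mem_ofPred_eq] at *
    rw [conjTranspose_smul, hZ, star_trivial, smul_neg]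

theorem mem_skewHermitian_iff {m : Type*} {Z : Matrix m m ℂ} :
    Z ∈ skewHermitian m ↔ Zᴴ = -Z := Iff.rfl

/-- Multiplication by `I` exchanges the skew-Hermitian and the Hermitian matrices, which together
span all matrices; so both have half of the real dimension `2 m²`. -/
theorem finrank_skewHermitian (m : Type*) [Fintype m] :
    Module.finrank ℝ (skewHermitian m) = Fintype.card m ^ 2 := by
  let T : Matrix m m ℂ →ₗ[ℝ] Matrix m m ℂ :=
    { toFun := fun A => A - Aᴴ
      map_add' := fun A B => by rw [conjTranspose_add]; abel
      map_smul' := fun r A => by simp [conjTranspose_smul, smul_sub] }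
  let e : Matrix m m ℂ ≃ₗ[ℝ] Matrix m m ℂ :=
    (LinearEquiv.smulOfNeZero ℂ (Matrix m m ℂ) Complex.I Complex.I_ne_zero).restrictScalars ℝ
  have hT : ∀ A, T A = A - Aᴴ := fun A => rfl
  have he : ∀ A, e A = Complex.I • A := fun A => rfl
  have hrange : LinearMap.range T = skewHermitian m := by
    ext Z
    rw [LinearMap.mem_range, mem_skewHermitian_iff]
    constructor
    · rintro ⟨A, rfl⟩
      rw [hT, conjTranspose_sub, conjTranspose_conjTranspose, neg_sub]
    · intro hZ
      refine ⟨(1 / 2 : ℝ) • Z, ?_⟩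
      rw [hT, conjTranspose_smul, hZ, star_trivial]
      module
  have hker : LinearMap.ker T = (skewHermitian m).map (e : Matrix m m ℂ →ₗ[ℝ] Matrix m m ℂ) := by
    ext Z
    rw [LinearMap.mem_ker, hT, sub_eq_zero, Submodule.mem_map]
    constructor
    · intro hZ
      refine ⟨-(Complex.I • Z), ?_, ?_⟩
      · rw [mem_skewHermitian_iff, conjTranspose_neg, conjTranspose_smul, ← hZ, RCLike.star_def,
          Complex.conj_I]
        module
      · rw [LinearEquiv.coe_coe, he, smul_neg, smul_smul, Complex.I_mul_I, neg_smul, one_smul,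
          neg_neg]
    · rintro ⟨Y, hY, rfl⟩
      rw [LinearEquiv.coe_coe, he, conjTranspose_smul, mem_skewHermitian_iff.1 hY, RCLike.star_def,
          Complex.conj_I]
      module
  have h1 := T.finrank_range_add_finrank_ker
  rw [hrange, hker, LinearEquiv.finrank_map_eq, Module.finrank_matrix, Complex.finrank_real_complex]
    at h1
  nlinarith

variable {n I : ℕ}

/-- The skew-Hermitian matrices whose diagonal blocks (the positions `(a, c)` with `b a = b c`) are
scalar matrices; the entries outside these blocks are free. -/
def skewScalarBlocks (b : Fin n → Fin I) : Submodule ℝ (Matrix (Fin n) (Fin n) ℂ) where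
  carrier := {Z | Zᴴ = -Z ∧
    ∃ t : Fin I → ℂ, ∀ a c, b a = b c → Z a c = if a = c then t (b a) else 0}
  add_mem' := by
    rintro Y Z ⟨hY, t, ht⟩ ⟨hZ, s, hs⟩
    refine ⟨by rw [conjTranspose_add, hY, hZ, neg_add], t + s, fun a c h => ?_⟩
    rw [Matrix.add_apply, ht a c h, hs a c h]
    split_ifs <;> simp
  zero_mem' := ⟨by simp, 0, by simp⟩
  smul_mem' := by
    rintro r Z ⟨hZ, t, ht⟩
    refine ⟨by rw [conjTranspose_smul, hZ, star_trivial, smul_neg], r • t, fun a c h => ?_⟩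
    rw [Matrix.smul_apply, ht a c h]
    split_ifs <;> simp

theorem mem_skewScalarBlocks_iff {b : Fin n → Fin I} {Z : Matrix (Fin n) (Fin n) ℂ} :
    Z ∈ skewScalarBlocks b ↔ Z ∈ skewHermitian (Fin n) ∧
      ∃ t : Fin I → ℂ, ∀ a c, b a = b c → Z a c = if a = c then t (b a) else 0 := Iff.rfl

theorem skewScalarBlocks_le (b : Fin n → Fin I) : skewScalarBlocks b ≤ skewHermitian (Fin n) :=
  fun _ h => h.1

/-- The family of the diagonal blocks of a skew-Hermitian matrix. -/
def blockRestriction (b : Fin n → Fin I) :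
    skewHermitian (Fin n) →ₗ[ℝ] ((i : Fin I) → skewHermitian {a // b a = i}) where
  toFun Z i := ⟨Z.1.submatrix Subtype.val Subtype.val, by
    rw [mem_skewHermitian_iff, conjTranspose_submatrix, mem_skewHermitian_iff.1 Z.2]; rfl⟩
  map_add' _ _ := rfl
  map_smul' _ _ := rfl

/-- The families of skew-Hermitian blocks that are imaginary multiples `t i * I` of the identity. -/
noncomputable def imaginaryScalars (b : Fin n → Fin I) :
    (Fin I → ℝ) →ₗ[ℝ] ((i : Fin I) → skewHermitian {a // b a = i}) where
  toFun t i := ⟨t i • Complex.I • 1, by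
    rw [mem_skewHermitian_iff, conjTranspose_smul, conjTranspose_smul, conjTranspose_one,
      star_trivial, RCLike.star_def, Complex.conj_I, neg_smul, smul_neg]⟩
  map_add' s t := by
    ext i : 2
    simp [add_smul]
  map_smul' r t := by
    ext i : 2
    simp [mul_smul]

theorem blockRestriction_apply (b : Fin n → Fin I) (Z : skewHermitian (Fin n)) (i : Fin I)
    (x y : {a // b a = i}) : (blockRestriction b Z i).1 x y = Z.1 x y := rfl

theorem imaginaryScalars_apply (b : Fin n → Fin I) (t : Fin I → ℝ) (i : Fin I)
    (x y : {a // b a = i}) :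
    (imaginaryScalars b t i).1 x y = if x.1 = y.1 then t i * Complex.I else 0 := by
  simp only [imaginaryScalars, LinearMap.coe_mk, AddHom.coe_mk, Matrix.smul_apply, one_apply,
    Subtype.ext_iff]
  split_ifs <;> simp

theorem blockRestriction_surjective (b : Fin n → Fin I) :
    Function.Surjective (blockRestriction b) := by
  intro Y
  let Z : Matrix (Fin n) (Fin n) ℂ :=
    Matrix.of fun a c => if h : b c = b a then (Y (b a)).1 ⟨a, rfl⟩ ⟨c, h⟩ else 0
  have hY : ∀ i x y, star ((Y i).1 x y) = -(Y i).1 y x := fun i x y =>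
    congrFun (congrFun (mem_skewHermitian_iff.1 (Y i).2) y) x
  have hZ' : ∀ i (a c : {a // b a = i}), Z a c = (Y i).1 a c := by
    rintro i ⟨a, rfl⟩ ⟨c, hc⟩
    simp [Z, hc]
  have hZ : Z ∈ skewHermitian (Fin n) := by
    rw [mem_skewHermitian_iff]
    ext a c
    rw [conjTranspose_apply, Matrix.neg_apply]
    by_cases h : b c = b a
    · have h1 := hZ' (b a) ⟨a, rfl⟩ ⟨c, h⟩
      have h2 := hZ' (b a) ⟨c, h⟩ ⟨a, rfl⟩
      simp only at h1 h2
      rw [h1, h2, hY]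
    · have h' : ¬ b a = b c := fun h' => h h'.symm
      simp [Z, h, h']
  refine ⟨⟨Z, hZ⟩, ?_⟩
  ext i a c
  exact hZ' i a c

theorem imaginaryScalars_injective {b : Fin n → Fin I} (hb : Function.Surjective b) :
    Function.Injective (imaginaryScalars b) := by
  intro s t hst
  ext i
  obtain ⟨a, rfl⟩ := hb i
  have h := congrFun (congrFun (congrArg Subtype.val (congrFun hst (b a))) ⟨a, rfl⟩) ⟨a, rfl⟩
  simpa [imaginaryScalars_apply] using h

/-- The subspace `skewScalarBlocks b` is the preimage of the imaginary scalars under the surjective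
map `blockRestriction b`. -/
theorem finrank_skewScalarBlocks {b : Fin n → Fin I} (hb : Function.Surjective b) :
    Module.finrank ℝ (skewScalarBlocks b) + ∑ i, Fintype.card {a // b a = i} ^ 2 = n ^ 2 + I := by
  set R := LinearMap.range (imaginaryScalars b)
  have hcomap : (skewScalarBlocks b).comap (skewHermitian (Fin n)).subtype =
      LinearMap.ker (R.mkQ ∘ₗ blockRestriction b) := by
    ext ⟨Z, hZ⟩
    rw [LinearMap.mem_ker, LinearMap.comp_apply, Submodule.mkQ_apply, Submodule.Quotient.mk_eq_zero,
      LinearMap.mem_range, Submodule.mem_comap, Submodule.subtype_apply, mem_skewScalarBlocks_iff]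
    constructor
    · rintro ⟨-, t, ht⟩
      refine ⟨fun i => (t i).im, ?_⟩
      ext i ⟨a, rfl⟩ ⟨c, hc⟩
      have h1 := ht a c hc.symm
      have hre : (t (b a)).re = 0 := by
        have h2 := congrFun (congrFun (mem_skewHermitian_iff.1 hZ) a) a
        have h3 := congrArg Complex.re h2
        have h4 : Z a a = t (b a) := by simpa using ht a a rfl
        simp only [conjTranspose_apply, Matrix.neg_apply, RCLike.star_def, Complex.conj_re,
          Complex.neg_re, h4] at h3
        linarith
      have h5 : t (b a) = (t (b a)).im * Complex.I := by
        apply Complex.ext <;> simp [hre]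
      rw [imaginaryScalars_apply, blockRestriction_apply, h1, ← h5]
    · rintro ⟨t, ht⟩
      refine ⟨hZ, fun i => t i * Complex.I, fun a c hac => ?_⟩
      have h := congrFun (congrFun (congrArg Subtype.val (congrFun ht (b a))) ⟨a, rfl⟩)
        ⟨c, hac.symm⟩
      rw [imaginaryScalars_apply, blockRestriction_apply] at h
      exact h.symm
  have h1 := (R.mkQ ∘ₗ blockRestriction b).finrank_range_add_finrank_ker
  have hsurj : Function.Surjective (R.mkQ ∘ₗ blockRestriction b) := by
    rw [LinearMap.coe_comp]
    exact R.mkQ_surjective.comp (blockRestriction_surjective b)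
  rw [LinearMap.range_eq_top.2 hsurj, finrank_top, ← hcomap,
    (Submodule.comapSubtypeEquivOfLe (skewScalarBlocks_le b)).finrank_eq,
    finrank_skewHermitian, Fintype.card_fin] at h1
  have h2 := R.finrank_quotient_add_finrank
  rw [LinearMap.finrank_range_of_inj (imaginaryScalars_injective hb),
    Module.finrank_fintype_fun_eq_card, Fintype.card_fin, Module.finrank_pi_fintype] at h2
  simp only [finrank_skewHermitian] at h2
  omega

end Subspaces

/-! ### The Cayley transform -/

section Cayley

open Topology Set Matrix

variable {n : ℕ}

/-- The Cayley transform `(1 + X) (1 - X)⁻¹`, written as `2 (1 - X)⁻¹ - 1` so that its derivative is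
that of the inverse. It has a junk value where `1 - X` is singular. -/
noncomputable def cayley (X : Matrix (Fin n) (Fin n) ℂ) : Matrix (Fin n) (Fin n) ℂ :=
  (2 : ℝ) • Ring.inverse (1 - X) - 1

theorem cayley_zero : cayley (0 : Matrix (Fin n) (Fin n) ℂ) = 1 := by
  rw [cayley, sub_zero, Ring.inverse_one, two_smul, add_sub_cancel_right]

theorem cayley_mul_one_sub {X : Matrix (Fin n) (Fin n) ℂ} (hX : IsUnit (1 - X)) :
    cayley X * (1 - X) = 1 + X := by
  rw [cayley, Matrix.sub_mul, Matrix.smul_mul, Ring.inverse_mul_cancel _ hX, one_mul, two_smul]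
  abel

theorem cayley_mem_unitarySet {X : Matrix (Fin n) (Fin n) ℂ} (hX : IsUnit (1 - X))
    (hskew : Xᴴ = -X) : cayley X ∈ unitarySet n := by
  rw [mem_unitarySet_iff]
  have h1 : (1 - X)ᴴ = 1 + X := by
    rw [conjTranspose_sub, conjTranspose_one, hskew, sub_neg_eq_add]
  have h2 : (1 + X)ᴴ = 1 - X := by
    rw [conjTranspose_add, conjTranspose_one, hskew, sub_eq_add_neg]
  have h3 : IsUnit (1 - X)ᴴ := hX.star
  -- `(1 - X)ᴴ (1 - X)` and `(1 + X)ᴴ (1 + X)` are both equal to `1 - X²`.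
  refine h3.mul_left_cancel (hX.mul_right_cancel ?_)
  calc (1 - X)ᴴ * ((cayley X)ᴴ * cayley X) * (1 - X)
      = (cayley X * (1 - X))ᴴ * (cayley X * (1 - X)) := by
        rw [conjTranspose_mul]; simp only [Matrix.mul_assoc]
    _ = (1 - X)ᴴ * 1 * (1 - X) := by
        rw [cayley_mul_one_sub hX, h1, h2, mul_one]
        noncomm_ring

theorem contDiffAt_cayley {X : Matrix (Fin n) (Fin n) ℂ} (hX : IsUnit (1 - X)) :
    ContDiffAt ℝ ω cayley X := by
  have : CompleteSpace (Matrix (Fin n) (Fin n) ℂ) := FiniteDimensional.complete ℝ _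
  obtain ⟨u, hu⟩ := hX
  have h := contDiffAt_ringInverse ℝ (n := ω) u
  rw [hu] at h
  have h1 : ContDiffAt ℝ ω (fun Y : Matrix (Fin n) (Fin n) ℂ => 1 - Y) X :=
    contDiffAt_const.sub contDiffAt_id
  exact ((h.comp X h1).const_smul (2 : ℝ)).sub contDiffAt_const

theorem hasFDerivAt_cayley_zero :
    HasFDerivAt cayley ((2 : ℝ) • ContinuousLinearMap.id ℝ (Matrix (Fin n) (Fin n) ℂ)) 0 := by
  have : CompleteSpace (Matrix (Fin n) (Fin n) ℂ) := FiniteDimensional.complete ℝ _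
  have h := hasFDerivAt_ringInverse (𝕜 := ℝ) (1 : (Matrix (Fin n) (Fin n) ℂ)ˣ)
  have h1 : HasFDerivAt (fun Y : Matrix (Fin n) (Fin n) ℂ => 1 - Y)
      (-ContinuousLinearMap.id ℝ (Matrix (Fin n) (Fin n) ℂ)) 0 := (hasFDerivAt_id _).const_sub 1
  have h2 : (1 : Matrix (Fin n) (Fin n) ℂ) - 0 =
      ((1 : (Matrix (Fin n) (Fin n) ℂ)ˣ) : Matrix _ _ ℂ) := by simp
  rw [← h2] at h
  have h3 := ((h.comp 0 h1).const_smul (2 : ℝ)).sub_const 1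
  refine h3.congr_fderiv ?_
  ext1 Y
  change (2 : ℝ) • -(((1 : (Matrix (Fin n) (Fin n) ℂ)ˣ)⁻¹ : (Matrix (Fin n) (Fin n) ℂ)ˣ).1 * (-Y) *
    ((1 : (Matrix (Fin n) (Fin n) ℂ)ˣ)⁻¹ : (Matrix (Fin n) (Fin n) ℂ)ˣ).1) = (2 : ℝ) • Y
  simp

theorem ringInverse_diagonal {v : Fin n → ℂ} (hv : IsUnit (diagonal v)) :
    Ring.inverse (diagonal v) = diagonal fun a => (v a)⁻¹ := by
  have hv0 : ∀ a, v a ≠ 0 := fun a =>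
    (Pi.isUnit_iff.1 (Matrix.isUnit_diagonal.1 hv) a).ne_zero
  refine left_inv_eq_right_inv (Ring.inverse_mul_cancel _ hv) ?_
  rw [diagonal_mul_diagonal, ← diagonal_one]
  congr 1
  ext a
  exact mul_inv_cancel₀ (hv0 a)

variable {I : ℕ}

/-- The Cayley transform and its inverse preserve the matrices that are a scalar on each block. -/
theorem exists_cayley_eq_diagonal_iff {b : Fin n → Fin I} {D : Matrix (Fin n) (Fin n) ℂ}
    (hD : IsUnit (1 - D)) :
    (∃ s : Fin I → ℂ, cayley D = diagonal fun a => s (b a)) ↔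
      ∃ t : Fin I → ℂ, D = diagonal fun a => t (b a) := by
  constructor
  · rintro ⟨s, hs⟩
    have h1 : Ring.inverse (1 - D) = diagonal fun a => (s (b a) + 1) / 2 := by
      have h2 : Ring.inverse (1 - D) = (1 / 2 : ℝ) • (cayley D + 1) := by
        rw [cayley]; module
      rw [h2, hs, ← diagonal_one, diagonal_add, ← diagonal_smul]
      congr 1
      ext a
      simp
      ring
    have h3 : 1 - D = diagonal fun a => ((s (b a) + 1) / 2)⁻¹ := by
      rw [← ringInverse_diagonal, ← h1]
      · obtain ⟨u, hu⟩ := hD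
        rw [← hu, Ring.inverse_unit, Ring.inverse_unit, inv_inv]
      · rw [← h1]
        exact hD.ringInverse
    refine ⟨fun i => 1 - ((s i + 1) / 2)⁻¹, ?_⟩
    rw [← sub_sub_cancel 1 D, h3, ← diagonal_one, diagonal_sub]
  · rintro ⟨t, rfl⟩
    have h1 : (1 : Matrix (Fin n) (Fin n) ℂ) - diagonal (fun a => t (b a)) =
        diagonal fun a => 1 - t (b a) := by
      rw [← diagonal_one, diagonal_sub]
    refine ⟨fun i => 2 * (1 - t i)⁻¹ - 1, ?_⟩
    rw [h1] at hD
    rw [cayley, h1, ringInverse_diagonal hD, ← diagonal_one, ← diagonal_smul, diagonal_sub]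
    congr 1

/-- A matrix is block diagonal iff it commutes with `diag (ν ∘ b)` for distinct `ν i`. -/
theorem commute_diagonal_iff {b : Fin n → Fin I} {ν : Fin I → ℂ} (hν : Function.Injective ν)
    {M : Matrix (Fin n) (Fin n) ℂ} :
    Commute M (diagonal fun a => ν (b a)) ↔ ∀ a c, b a ≠ b c → M a c = 0 := by
  rw [commute_iff_eq]
  constructor
  · intro h a c hac
    have h1 := congrFun (congrFun h a) c
    rw [mul_diagonal, diagonal_mul] at h1
    have h2 : (ν (b a) - ν (b c)) * M a c = 0 := by linear_combination -h1
    exact (mul_eq_zero.1 h2).resolve_left (sub_ne_zero.2 (hν.ne hac))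
  · intro h
    ext a c
    rw [mul_diagonal, diagonal_mul]
    by_cases hac : b a = b c
    · rw [hac, mul_comm]
    · rw [h a c hac]; simp

theorem Commute.cayley_left {D M : Matrix (Fin n) (Fin n) ℂ} (h : Commute D M)
    (hD : IsUnit (1 - D)) : Commute (cayley D) M := by
  obtain ⟨u, hu⟩ := hD
  have h1 : Commute (u : Matrix (Fin n) (Fin n) ℂ) M := hu ▸ (Commute.one_left M).sub_left h
  rw [cayley, ← hu, Ring.inverse_unit]
  exact (h1.units_inv_left.smul_left _).sub_left (Commute.one_left M)

end Cayley

/-! ### The parametrization near a diagonal unitary matrix -/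

section Parametrization

open Topology Set Matrix

variable {n I : ℕ}

/-- The skew-Hermitian part `(Z - Zᴴ) / 2` of a matrix. -/
noncomputable def skewPart : Matrix (Fin n) (Fin n) ℂ →L[ℝ] Matrix (Fin n) (Fin n) ℂ :=
  LinearMap.toContinuousLinearMap
    { toFun := fun Z => (1 / 2 : ℝ) • (Z - Zᴴ)
      map_add' := fun Y Z => by rw [conjTranspose_add]; module
      map_smul' := fun r Z => by rw [conjTranspose_smul, star_trivial, RingHom.id_apply]; module }

/-- The Hermitian part `(Z + Zᴴ) / 2` of a matrix. -/
noncomputable def hermitianPart : Matrix (Fin n) (Fin n) ℂ →L[ℝ] Matrix (Fin n) (Fin n) ℂ :=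
  LinearMap.toContinuousLinearMap
    { toFun := fun Z => (1 / 2 : ℝ) • (Z + Zᴴ)
      map_add' := fun Y Z => by rw [conjTranspose_add]; module
      map_smul' := fun r Z => by rw [conjTranspose_smul, star_trivial, RingHom.id_apply]; module }

/-- The projection to the block diagonal matrices, the blocks being the classes of `b`. -/
noncomputable def diagBlocks (b : Fin n → Fin I) :
    Matrix (Fin n) (Fin n) ℂ →L[ℝ] Matrix (Fin n) (Fin n) ℂ :=
  LinearMap.toContinuousLinearMap
    { toFun := fun Z => Matrix.of fun a c => if b a = b c then Z a c else 0
      map_add' := fun Y Z => by ext a c; simp only [of_apply, Matrix.add_apply]; split_ifs <;> simp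
      map_smul' := fun r Z => by
        ext a c; simp only [of_apply, Matrix.smul_apply, RingHom.id_apply]; split_ifs <;> simp }

/-- The projection to the matrices whose diagonal blocks vanish. -/
noncomputable def offDiagBlocks (b : Fin n → Fin I) :
    Matrix (Fin n) (Fin n) ℂ →L[ℝ] Matrix (Fin n) (Fin n) ℂ :=
  ContinuousLinearMap.id ℝ _ - diagBlocks b

theorem skewPart_apply (Z : Matrix (Fin n) (Fin n) ℂ) :
    skewPart Z = (1 / 2 : ℝ) • (Z - Zᴴ) := rfl

theorem hermitianPart_apply (Z : Matrix (Fin n) (Fin n) ℂ) :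
    hermitianPart Z = (1 / 2 : ℝ) • (Z + Zᴴ) := rfl

theorem diagBlocks_apply (b : Fin n → Fin I) (Z : Matrix (Fin n) (Fin n) ℂ) (a c : Fin n) :
    diagBlocks b Z a c = if b a = b c then Z a c else 0 := rfl

theorem offDiagBlocks_apply (b : Fin n → Fin I) (Z : Matrix (Fin n) (Fin n) ℂ) (a c : Fin n) :
    offDiagBlocks b Z a c = if b a = b c then 0 else Z a c := by
  rw [offDiagBlocks, _root_.sub_apply, Matrix.sub_apply, diagBlocks_apply]
  split_ifs <;> simp

theorem conjTranspose_skewPart (Z : Matrix (Fin n) (Fin n) ℂ) : (skewPart Z)ᴴ = -skewPart Z := by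
  rw [skewPart_apply, conjTranspose_smul, conjTranspose_sub, conjTranspose_conjTranspose,
    star_trivial]
  module

theorem conjTranspose_hermitianPart (Z : Matrix (Fin n) (Fin n) ℂ) :
    (hermitianPart Z)ᴴ = hermitianPart Z := by
  rw [hermitianPart_apply, conjTranspose_smul, conjTranspose_add, conjTranspose_conjTranspose,
    star_trivial]
  module

theorem skewPart_add_hermitianPart (Z : Matrix (Fin n) (Fin n) ℂ) :
    skewPart Z + hermitianPart Z = Z := by
  rw [skewPart_apply, hermitianPart_apply]; module

theorem hermitianPart_eq_zero_iff {Z : Matrix (Fin n) (Fin n) ℂ} :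
    hermitianPart Z = 0 ↔ Z ∈ skewHermitian (Fin n) := by
  rw [hermitianPart_apply, smul_eq_zero_iff_right (by norm_num), mem_skewHermitian_iff,
    add_comm, eq_neg_iff_add_eq_zero]

theorem conjTranspose_diagBlocks (b : Fin n → Fin I) (Z : Matrix (Fin n) (Fin n) ℂ) :
    (diagBlocks b Z)ᴴ = diagBlocks b Zᴴ := by
  ext a c
  rw [conjTranspose_apply, diagBlocks_apply, diagBlocks_apply, conjTranspose_apply]
  by_cases h : b a = b c
  · simp [h]
  · simp [h, Ne.symm h]

theorem conjTranspose_offDiagBlocks (b : Fin n → Fin I) (Z : Matrix (Fin n) (Fin n) ℂ) :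
    (offDiagBlocks b Z)ᴴ = offDiagBlocks b Zᴴ := by
  ext a c
  rw [conjTranspose_apply, offDiagBlocks_apply, offDiagBlocks_apply, conjTranspose_apply]
  by_cases h : b a = b c
  · simp [h]
  · simp [h, Ne.symm h]

/-- The parametrization of the matrices near `Λ = diag (ν ∘ b)`. The part of `Z` off the diagonal
blocks rotates the eigenspaces, the diagonal blocks perturb the eigenvalues, and the Hermitian part
moves away from the unitary matrices. -/
noncomputable def unitaryParam (b : Fin n → Fin I) (ν : Fin I → ℂ) (Z : Matrix (Fin n) (Fin n) ℂ) :
    Matrix (Fin n) (Fin n) ℂ :=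
  cayley (offDiagBlocks b (skewPart Z)) *
    ((diagonal fun a => ν (b a)) * cayley (diagBlocks b (skewPart Z))) *
    (cayley (offDiagBlocks b (skewPart Z)))ᴴ * (1 + hermitianPart Z)

theorem unitaryParam_zero (b : Fin n → Fin I) (ν : Fin I → ℂ) :
    unitaryParam b ν 0 = diagonal fun a => ν (b a) := by
  simp [unitaryParam, cayley_zero]

/-- The conjugate transpose as a continuous real-linear map. -/
noncomputable def conjTransposeCLM :
    Matrix (Fin n) (Fin n) ℂ →L[ℝ] Matrix (Fin n) (Fin n) ℂ :=
  LinearMap.toContinuousLinearMap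
    { toFun := fun Z => Zᴴ
      map_add' := fun Y Z => conjTranspose_add Y Z
      map_smul' := fun r Z => by rw [conjTranspose_smul, star_trivial, RingHom.id_apply] }

theorem contDiffAt_unitaryParam (b : Fin n → Fin I) (ν : Fin I → ℂ) :
    ContDiffAt ℝ ω (unitaryParam b ν) 0 := by
  have hc : ∀ L : Matrix (Fin n) (Fin n) ℂ →L[ℝ] Matrix (Fin n) (Fin n) ℂ,
      ContDiffAt ℝ ω (fun Z => cayley (L Z)) 0 := fun L =>
    (contDiffAt_cayley (X := L 0) (by simp)).comp 0 L.contDiff.contDiffAt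
  have h1 := hc ((offDiagBlocks b).comp skewPart)
  have h2 := hc ((diagBlocks b).comp skewPart)
  have h3 : ContDiffAt ℝ ω (fun Z => (cayley (offDiagBlocks b (skewPart Z)))ᴴ) 0 :=
    (conjTransposeCLM (n := n)).contDiff.contDiffAt.comp 0 h1
  have h4 : ContDiffAt ℝ ω (fun Z : Matrix (Fin n) (Fin n) ℂ => 1 + hermitianPart Z) 0 :=
    contDiffAt_const.add hermitianPart.contDiff.contDiffAt
  exact ((h1.mul (contDiffAt_const.mul h2)).mul h3).mul h4

/-- The derivative of `unitaryParam b ν` at `0` is `Z ↦ 2 (X Λ - Λ X) + Λ (2 D + P)`,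
here entrywise. -/
theorem exists_hasFDerivAt_unitaryParam (b : Fin n → Fin I) (ν : Fin I → ℂ) :
    ∃ F' : Matrix (Fin n) (Fin n) ℂ →L[ℝ] Matrix (Fin n) (Fin n) ℂ,
      HasFDerivAt (unitaryParam b ν) F' 0 ∧ ∀ Z a c, F' Z a c =
        2 * offDiagBlocks b (skewPart Z) a c * (ν (b c) - ν (b a)) +
          ν (b a) * (2 * diagBlocks b (skewPart Z) a c + hermitianPart Z a c) := by
  have hc : ∀ L : Matrix (Fin n) (Fin n) ℂ →L[ℝ] Matrix (Fin n) (Fin n) ℂ,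
      HasFDerivAt (fun Z => cayley (L Z)) ((2 : ℝ) • L) 0 := fun L => by
    have h := hasFDerivAt_cayley_zero (n := n)
    rw [← map_zero L] at h
    refine (h.comp 0 L.hasFDerivAt).congr_fderiv ?_
    rfl
  have h1 := hc ((offDiagBlocks b).comp skewPart)
  have h2 := hc ((diagBlocks b).comp skewPart)
  have h3 := (conjTransposeCLM (n := n)).hasFDerivAt.comp 0 h1
  have h4 := (hermitianPart (n := n)).hasFDerivAt (x := 0) |>.const_add 1
  have h := ((h1.mul' (h2.const_mul (diagonal fun a => ν (b a)))).mul' h3).mul' h4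
  refine ⟨_, h, fun Z a c => ?_⟩
  have hX : (offDiagBlocks b (skewPart Z))ᴴ = -offDiagBlocks b (skewPart Z) := by
    rw [conjTranspose_offDiagBlocks, conjTranspose_skewPart, map_neg]
  change (cayley (offDiagBlocks b (skewPart 0)) *
      ((diagonal fun a => ν (b a)) * cayley (diagBlocks b (skewPart 0))) *
      (cayley (offDiagBlocks b (skewPart 0)))ᴴ * hermitianPart Z +
    (cayley (offDiagBlocks b (skewPart 0)) *
        ((diagonal fun a => ν (b a)) * cayley (diagBlocks b (skewPart 0))) *
        ((2 : ℝ) • offDiagBlocks b (skewPart Z))ᴴ +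
      (cayley (offDiagBlocks b (skewPart 0)) *
          ((diagonal fun a => ν (b a)) * ((2 : ℝ) • diagBlocks b (skewPart Z))) +
        ((2 : ℝ) • offDiagBlocks b (skewPart Z)) *
          ((diagonal fun a => ν (b a)) * cayley (diagBlocks b (skewPart 0)))) *
        (cayley (offDiagBlocks b (skewPart 0)))ᴴ) * (1 + hermitianPart 0) :
    Matrix (Fin n) (Fin n) ℂ) a c = _
  rw [conjTranspose_smul, hX]
  simp only [map_zero, cayley_zero, conjTranspose_one, one_mul, mul_one, add_zero, star_trivial,
    Matrix.add_apply, diagonal_mul, mul_diagonal, Matrix.smul_apply, Matrix.neg_apply,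
    Complex.real_smul, Complex.ofReal_ofNat]
  ring

/-- If the derivative of `unitaryParam b ν` at `0` kills `Z`, then comparing the equation for the
entry `(a, c)` with the conjugate of the one for `(c, a)` separates the Hermitian part of `Z` from
the skew-Hermitian one. -/
theorem injective_of_forall_apply_eq {b : Fin n → Fin I} {ν : Fin I → ℂ}
    (hν : Function.Injective ν) (hnorm : ∀ i, ‖ν i‖ = 1)
    {F' : Matrix (Fin n) (Fin n) ℂ →L[ℝ] Matrix (Fin n) (Fin n) ℂ}
    (hF' : ∀ Z a c, F' Z a c =
        2 * offDiagBlocks b (skewPart Z) a c * (ν (b c) - ν (b a)) +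
          ν (b a) * (2 * diagBlocks b (skewPart Z) a c + hermitianPart Z a c)) :
    Function.Injective F' := by
  rw [injective_iff_map_eq_zero]
  intro Z hZ
  have hν1 : ∀ i, ν i * star (ν i) = 1 := fun i => by
    rw [RCLike.star_def, Complex.mul_conj', hnorm]; simp
  have hν0 : ∀ i, ν i ≠ 0 := fun i h => by simpa [h] using hν1 i
  -- Conjugating the equation for `(c, a)` changes the sign of the skew-Hermitian part only.
  have hS : ∀ a c, star (skewPart Z a c) = -skewPart Z c a := fun a c =>
    congrFun (congrFun (conjTranspose_skewPart Z) c) a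
  have hP : ∀ a c, star (hermitianPart Z a c) = hermitianPart Z c a := fun a c =>
    congrFun (congrFun (conjTranspose_hermitianPart Z) c) a
  have hE : ∀ a c, 2 * offDiagBlocks b (skewPart Z) a c * (ν (b c) - ν (b a)) +
      ν (b a) * (2 * diagBlocks b (skewPart Z) a c + hermitianPart Z a c) = 0 := fun a c => by
    rw [← hF', hZ]; rfl
  have main : ∀ a c, hermitianPart Z a c = 0 ∧ skewPart Z a c = 0 := by
    intro a c
    have h1 := hE a c
    have h2 := congrArg star (hE c a)
    rw [diagBlocks_apply, offDiagBlocks_apply] at h1 h2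
    by_cases h : b a = b c
    · rw [if_pos h, if_pos h, h, sub_self] at h1
      rw [if_pos h.symm, if_pos h.symm, h, sub_self] at h2
      have h3 : 2 * skewPart Z a c + hermitianPart Z a c = 0 := by
        have : ν (b c) * (2 * skewPart Z a c + hermitianPart Z a c) = 0 := by
          linear_combination h1
        exact (mul_eq_zero.1 this).resolve_left (hν0 _)
      have h4 : -2 * skewPart Z a c + hermitianPart Z a c = 0 := by
        have : star (ν (b c)) * (-2 * skewPart Z a c + hermitianPart Z a c) = 0 := by
          simp only [star_add, star_mul', hS, hP, star_zero, star_ofNat] at h2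
          linear_combination h2
        exact (mul_eq_zero.1 this).resolve_left (star_ne_zero.2 (hν0 _))
      exact ⟨by linear_combination (h3 + h4) / 2, by linear_combination (h3 - h4) / 4⟩
    · have h' : ¬ b c = b a := fun h' => h h'.symm
      rw [if_neg h, if_neg h] at h1
      rw [if_neg h', if_neg h'] at h2
      simp only [star_add, star_sub, star_mul', hS, hP, star_zero, star_ofNat] at h2
      have h3 : hermitianPart Z a c = 0 := by
        have : ν (b a) * hermitianPart Z a c = 0 := by
          linear_combination (1 / 2) * h1 + (1 / 2) * ν (b a) * ν (b c) * h2 +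
            skewPart Z a c * ν (b c) * hν1 (b a) -
            (skewPart Z a c * ν (b a) + ν (b a) * hermitianPart Z a c / 2) * hν1 (b c)
        exact (mul_eq_zero.1 this).resolve_left (hν0 _)
      refine ⟨h3, ?_⟩
      have : (ν (b c) - ν (b a)) * skewPart Z a c = 0 := by
        rw [h3] at h1
        linear_combination h1 / 2
      exact (mul_eq_zero.1 this).resolve_left (sub_ne_zero.2 (hν.ne h'))
  rw [← skewPart_add_hermitianPart Z]
  ext a c
  simp [main a c]

end Parametrization

/-! ### Charts adapted to the multiplicities -/

section Charts

open Topology Set Matrix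

variable {n I : ℕ}

theorem one_add_mem_unitarySet_iff {P : Matrix (Fin n) (Fin n) ℂ} (hP : Pᴴ = P)
    (hu : IsUnit (2 + P)) : 1 + P ∈ unitarySet n ↔ P = 0 := by
  have h : (1 + P)ᴴ * (1 + P) = 1 + (2 + P) * P := by
    rw [conjTranspose_add, conjTranspose_one, hP]
    noncomm_ring
  rw [mem_unitarySet_iff, h, add_eq_left, hu.mul_right_eq_zero]

/-- Near `0`, the parametrization turns unitary matrices into skew-Hermitian ones, and those with
the multiplicities of `diag (ν ∘ b)` into `skewScalarBlocks b`. -/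
theorem unitaryParam_mem_iff {b : Fin n → Fin I} {ν : Fin I → ℂ}
    (hν : Function.Injective ν) (hnorm : ∀ i, ‖ν i‖ = 1) (hb : Function.Surjective b) {ε : ℝ}
    (hε : ∀ i j, i ≠ j → 2 * ε ≤ ‖ν i - ν j‖) {Z : Matrix (Fin n) (Fin n) ℂ}
    (hX : IsUnit (1 - offDiagBlocks b (skewPart Z))) (hD : IsUnit (1 - diagBlocks b (skewPart Z)))
    (hP : IsUnit (2 + hermitianPart Z))
    (hZε : ‖(diagonal fun a => ν (b a)) * cayley (diagBlocks b (skewPart Z)) -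
      diagonal fun a => ν (b a)‖ < ε) :
    (unitaryParam b ν Z ∈ unitarySet n ↔ Z ∈ skewHermitian (Fin n)) ∧
    (unitaryParam b ν Z ∈ unitaryWithMult n (fun i => Fintype.card {a // b a = i}) ↔
      Z ∈ skewScalarBlocks b) := by
  set X := offDiagBlocks b (skewPart Z) with hXdef
  set D := diagBlocks b (skewPart Z) with hDdef
  set Λ : Matrix (Fin n) (Fin n) ℂ := diagonal fun a => ν (b a) with hΛdef
  have hXs : Xᴴ = -X := by
    rw [hXdef, conjTranspose_offDiagBlocks, conjTranspose_skewPart, map_neg]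
  have hDs : Dᴴ = -D := by
    rw [hDdef, conjTranspose_diagBlocks, conjTranspose_skewPart, map_neg]
  have hcX := cayley_mem_unitarySet hX hXs
  have hcD := cayley_mem_unitarySet hD hDs
  have hΛ : Λ ∈ unitarySet n := diagonal_mem_unitarySet_iff.2 fun a => hnorm _
  have hB : Λ * cayley D ∈ unitarySet n := mul_mem_unitarySet hΛ hcD
  have hG : cayley X * (Λ * cayley D) * (cayley X)ᴴ ∈ unitarySet n :=
    (conj_mem_unitarySet_iff hcX).2 hB
  have hdef : unitaryParam b ν Z =
      cayley X * (Λ * cayley D) * (cayley X)ᴴ * (1 + hermitianPart Z) := rfl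
  have hU : unitaryParam b ν Z ∈ unitarySet n ↔ Z ∈ skewHermitian (Fin n) := by
    rw [← hermitianPart_eq_zero_iff, ← one_add_mem_unitarySet_iff (conjTranspose_hermitianPart Z) hP,
      hdef]
    refine ⟨fun h => ?_, mul_mem_unitarySet hG⟩
    have h1 := mul_mem_unitarySet (conjTranspose_mem_unitarySet hG) h
    rwa [← Matrix.mul_assoc, conjTranspose_mul_self_of_mem hG, one_mul] at h1
  refine ⟨hU, ?_⟩
  rw [mem_skewScalarBlocks_iff, ← hU]
  refine and_congr_right fun hmem => ?_
  have hZ := hU.1 hmem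
  have hZ0 := hermitianPart_eq_zero_iff.2 hZ
  have hskew : skewPart Z = Z := by
    have h := skewPart_add_hermitianPart Z
    rwa [hZ0, add_zero] at h
  have hDblock : Commute D Λ := (commute_diagonal_iff hν).2 fun a c hac => by
    rw [hDdef, diagBlocks_apply, if_neg hac]
  have hBblock : ∀ a c, b a ≠ b c → (Λ * cayley D) a c = 0 :=
    (commute_diagonal_iff hν).1 ((Commute.refl Λ).mul_left (hDblock.cayley_left hD))
  rw [hdef, hZ0, add_zero, mul_one, hasMultiplicities_conj_iff hcX,
    hasMultiplicities_iff_of_norm_sub_lt hb hε hB hBblock hZε]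
  have hΛ' : (∃ ν' : Fin I → ℂ, Λ * cayley D = diagonal fun a => ν' (b a)) ↔
      ∃ s : Fin I → ℂ, cayley D = diagonal fun a => s (b a) := by
    have hinv : ∀ i, star (ν i) * ν i = 1 := fun i => by
      rw [RCLike.star_def, Complex.conj_mul', hnorm]; simp
    constructor
    · rintro ⟨ν', h⟩
      refine ⟨fun i => star (ν i) * ν' i, ?_⟩
      have h1 : Λᴴ * (Λ * cayley D) = cayley D := by
        rw [← Matrix.mul_assoc, conjTranspose_mul_self_of_mem hΛ, one_mul]
      rw [← h1, h, hΛdef, diagonal_conjTranspose, diagonal_mul_diagonal]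
      rfl
    · rintro ⟨s, h⟩
      exact ⟨fun i => ν i * s i, by rw [h, hΛdef, diagonal_mul_diagonal]⟩
  rw [hΛ', exists_cayley_eq_diagonal_iff hD]
  refine exists_congr fun t => ?_
  constructor
  · intro h a c hac
    have h1 := congrFun (congrFun h a) c
    rw [hDdef, diagBlocks_apply, if_pos hac, hskew] at h1
    rw [h1, diagonal_apply]
  · intro h
    ext a c
    rw [hDdef, diagBlocks_apply, hskew, diagonal_apply]
    split_ifs with h1 h2 h2
    · rw [h a c h1, if_pos h2]
    · rw [h a c h1, if_neg h2]
    · exact absurd (congrArg b h2) h1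
    · rfl

theorem eventually_isUnit_and_norm_lt (b : Fin n → Fin I) (ν : Fin I → ℂ) {ε : ℝ} (hε : 0 < ε) :
    ∀ᶠ Z in 𝓝 (0 : Matrix (Fin n) (Fin n) ℂ),
      IsUnit (1 - offDiagBlocks b (skewPart Z)) ∧ IsUnit (1 - diagBlocks b (skewPart Z)) ∧
      IsUnit (2 + hermitianPart Z) ∧
      ‖(diagonal fun a => ν (b a)) * cayley (diagBlocks b (skewPart Z)) -
        diagonal fun a => ν (b a)‖ < ε := by
  have : CompleteSpace (Matrix (Fin n) (Fin n) ℂ) := FiniteDimensional.complete ℝ _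
  have hopen : IsOpen {A : Matrix (Fin n) (Fin n) ℂ | IsUnit A} := Units.isOpen
  have hunit : ∀ f : Matrix (Fin n) (Fin n) ℂ → Matrix (Fin n) (Fin n) ℂ, ContinuousAt f 0 →
      IsUnit (f 0) → ∀ᶠ Z in 𝓝 0, IsUnit (f Z) := fun f hf h0 => hf (hopen.mem_nhds h0)
  have h2 : IsUnit (2 : Matrix (Fin n) (Fin n) ℂ) := by
    have h := (isUnit_iff_ne_zero.2 (two_ne_zero (α := ℂ))).map
      (algebraMap ℂ (Matrix (Fin n) (Fin n) ℂ))
    rwa [map_ofNat] at h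
  have hc : ContinuousAt (fun Z : Matrix (Fin n) (Fin n) ℂ =>
      ‖(diagonal fun a => ν (b a)) * cayley (diagBlocks b (skewPart Z)) -
        diagonal fun a => ν (b a)‖) 0 := by
    have h1 : ContinuousAt cayley (diagBlocks b (skewPart (0 : Matrix (Fin n) (Fin n) ℂ))) :=
      (contDiffAt_cayley (by simp)).continuousAt
    have h3 : ContinuousAt (fun Z => cayley (diagBlocks b (skewPart Z))) 0 :=
      ContinuousAt.comp (f := fun Z => diagBlocks b (skewPart Z)) h1
        ((diagBlocks b).comp skewPart).continuous.continuousAt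
    exact ((continuousAt_const.mul h3).sub continuousAt_const).norm
  refine (hunit _ (continuousAt_const.sub
      ((offDiagBlocks b).comp skewPart).continuous.continuousAt) (by simp)).and
    ((hunit _ (continuousAt_const.sub
      ((diagBlocks b).comp skewPart).continuous.continuousAt) (by simp)).and
    ((hunit _ (continuousAt_const.add hermitianPart.continuous.continuousAt)
      (by simpa using h2)).and ?_))
  refine hc.eventually_lt continuousAt_const ?_
  simpa [cayley_zero] using hε

/-- Around each unitary matrix with multiplicities `k` there is a chart in which both the unitary
matrices and those with multiplicities `k` are linear subspaces of the expected dimensions. -/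
theorem exists_adapted_chart {k : Fin I → ℕ} {A : Matrix (Fin n) (Fin n) ℂ}
    (hA : A ∈ unitaryWithMult n k) :
    ∃ (φ : OpenPartialHomeomorph (Matrix (Fin n) (Fin n) ℂ) (Matrix (Fin n) (Fin n) ℂ))
      (V W : Submodule ℝ (Matrix (Fin n) (Fin n) ℂ)),
      A ∈ φ.source ∧ IsSmoothChart φ ∧ IsSliceOn φ (unitarySet n) V ∧
      IsSliceOn φ (unitaryWithMult n k) W ∧ W ≤ V ∧ Module.finrank ℝ V = n ^ 2 ∧
      Module.finrank ℝ W + ∑ i, k i ^ 2 = n ^ 2 + I := by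
  obtain ⟨W₀, hW₀, b, ν, hb, hν, hnorm, hk, rfl⟩ := exists_diagonalization_of_mem_unitaryWithMult hA
  obtain rfl : k = fun i => Fintype.card {a // b a = i} := funext hk
  obtain ⟨ε, hε0, hε⟩ := exists_pos_two_mul_le_norm_sub hν
  let C : Matrix (Fin n) (Fin n) ℂ →L[ℝ] Matrix (Fin n) (Fin n) ℂ :=
    LinearMap.toContinuousLinearMap
      { toFun := fun Z => W₀ * Z * W₀ᴴ
        map_add' := fun Y Z => by rw [Matrix.mul_add, Matrix.add_mul]
        map_smul' := fun r Z => by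
          rw [Matrix.mul_smul, Matrix.smul_mul, RingHom.id_apply] }
  have hC : ∀ Z, C Z = W₀ * Z * W₀ᴴ := fun Z => rfl
  have hCinj : Function.Injective C := by
    refine Function.LeftInverse.injective (g := fun Z => W₀ᴴ * Z * W₀) fun Z => ?_
    rw [hC]
    calc W₀ᴴ * (W₀ * Z * W₀ᴴ) * W₀ = (W₀ᴴ * W₀) * Z * (W₀ᴴ * W₀) := by
          simp only [Matrix.mul_assoc]
      _ = Z := by rw [conjTranspose_mul_self_of_mem hW₀, one_mul, mul_one]
  obtain ⟨F', hF', hF'apply⟩ := exists_hasFDerivAt_unitaryParam b ν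
  have hF'inj := injective_of_forall_apply_eq hν hnorm hF'apply
  obtain ⟨φ, hφ, hsmooth, hφF⟩ := exists_isSmoothChart_of_contDiffAt
    (F := fun Z => C (unitaryParam b ν Z)) (F' := C.comp F')
    (C.contDiff.contDiffAt.comp 0 (contDiffAt_unitaryParam b ν)) (C.hasFDerivAt.comp 0 hF')
    (hCinj.comp hF'inj) (eventually_isUnit_and_norm_lt b ν hε0)
  have hslice : ∀ y ∈ φ.source, (y ∈ unitarySet n ↔ φ y ∈ skewHermitian (Fin n)) ∧
      (y ∈ unitaryWithMult n (fun i => Fintype.card {a // b a = i}) ↔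
        φ y ∈ skewScalarBlocks b) := fun y hy => by
    obtain ⟨hFy, hX, hD, hP, hZε⟩ := hφF y hy
    have h := unitaryParam_mem_iff hν hnorm hb hε hX hD hP hZε
    rw [← h.1, ← h.2]
    generalize unitaryParam b ν (φ y) = M at hFy
    rw [← hFy, hC]
    exact ⟨conj_mem_unitarySet_iff hW₀,
      and_congr (conj_mem_unitarySet_iff hW₀) (hasMultiplicities_conj_iff hW₀)⟩
  refine ⟨φ, skewHermitian (Fin n), skewScalarBlocks b, ?_, hsmooth, fun y hy => (hslice y hy).1,
    fun y hy => (hslice y hy).2, skewScalarBlocks_le b, ?_, finrank_skewScalarBlocks hb⟩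
  · rwa [unitaryParam_zero] at hφ
  · rw [finrank_skewHermitian, Fintype.card_fin]

theorem isSubmanifoldOfDim_unitarySet (n : ℕ) :
    IsSubmanifoldOfDim (unitarySet n) ((n ^ 2 : ℕ) : ℤ) := by
  intro A hA
  obtain ⟨I, k, -, -, hk⟩ := exists_mem_unitaryWithMult hA
  obtain ⟨φ, V, W, hφ, hs, hV, -, -, hd, -⟩ := exists_adapted_chart hk
  exact ⟨φ, V, hφ, hs, hV, by rw [hd]⟩

theorem isSubmanifoldOfDim_unitaryWithMult {k : Fin I → ℕ} :
    IsSubmanifoldOfDim (unitaryWithMult n k) ((n : ℤ) ^ 2 - ∑ i, ((k i : ℤ) ^ 2 - 1)) := by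
  intro A hA
  obtain ⟨φ, V, W, hφ, hs, -, hW, -, -, hd⟩ := exists_adapted_chart hA
  refine ⟨φ, W, hφ, hs, hW, ?_⟩
  have h : (Module.finrank ℝ W : ℤ) + ∑ i, (k i : ℤ) ^ 2 = (n : ℤ) ^ 2 + I := by exact_mod_cast hd
  simp only [Finset.sum_sub_distrib, Finset.sum_const, Finset.card_univ, Fintype.card_fin,
    nsmul_eq_mul, mul_one]
  linarith

theorem isSubmanifoldOfCodimIn_unitaryWithMult {k : Fin I → ℕ} :
    IsSubmanifoldOfCodimIn (unitaryWithMult n k) (unitarySet n) (∑ i, ((k i : ℤ) ^ 2 - 1)) := by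
  refine ⟨fun A hA => hA.1, fun A hA => ?_⟩
  obtain ⟨φ, V, W, hφ, hs, hV, hW, hle, hdV, hd⟩ := exists_adapted_chart hA
  refine ⟨φ, V, W, hφ, hs, hV, hW, hle, ?_⟩
  have h : (Module.finrank ℝ W : ℤ) + ∑ i, (k i : ℤ) ^ 2 = (n : ℤ) ^ 2 + I := by exact_mod_cast hd
  simp only [Finset.sum_sub_distrib, Finset.sum_const, Finset.card_univ, Fintype.card_fin,
    nsmul_eq_mul, mul_one]
  rw [hdV]
  push_cast
  linarith

end Charts

/-! ### Hausdorff dimensions -/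

section Dimensions

open Topology Set Matrix

variable {n I : ℕ}

theorem dimH_unitarySet (n : ℕ) : dimH (unitarySet n) = ((n ^ 2 : ℕ) : ENNReal) :=
  (isSubmanifoldOfDim_unitarySet n).dimH_eq ⟨1, (Matrix.unitaryGroup (Fin n) ℂ).one_mem⟩

theorem dimH_unitaryWithMult_add {k : Fin I → ℕ} (hk : ∀ i, 1 ≤ k i) (hsum : ∑ i, k i = n) :
    dimH (unitaryWithMult n k) + ((∑ i, (k i ^ 2 - 1) : ℕ) : ENNReal) = dimH (unitarySet n) := by
  have hne := unitaryWithMult_nonempty hk hsum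
  have hcast : ∑ i, ((k i : ℤ) ^ 2 - 1) = ((∑ i, (k i ^ 2 - 1) : ℕ) : ℤ) := by
    rw [Nat.cast_sum]
    refine Finset.sum_congr rfl fun i _ => ?_
    rw [Nat.cast_sub (Nat.one_le_pow _ _ (hk i))]
    push_cast
    rfl
  obtain ⟨A, hA⟩ := hne
  obtain ⟨φ, W, -, -, -, hd⟩ := isSubmanifoldOfDim_unitaryWithMult A hA
  have h := isSubmanifoldOfDim_unitaryWithMult (n := n) (k := k)
  rw [← hd] at h
  rw [h.dimH_eq ⟨A, hA⟩, dimH_unitarySet, ← Nat.cast_add]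
  congr 1
  rw [hcast] at hd
  refine Int.natCast_inj.1 ?_
  rw [Nat.cast_add, Nat.cast_pow, hd, sub_add_cancel]

theorem sum_cons_one {k : ℕ} (hkn : k ≤ n) :
    ∑ i, (Fin.cons k (fun _ => 1) : Fin (n - k + 1) → ℕ) i = n := by
  rw [Fin.sum_univ_succ]
  simp [hkn]

theorem one_le_cons_one {k : ℕ} (hk : 1 ≤ k) (i : Fin (n - k + 1)) :
    1 ≤ (Fin.cons k (fun _ => 1) : Fin (n - k + 1) → ℕ) i := by
  refine Fin.cases ?_ (fun j => ?_) i
  · exact hk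
  · exact le_rfl

/-- All multiplicities `k'` that contain `k` give codimension `∑ i, (k' i ^ 2 - 1) ≥ k ^ 2 - 1`,
with equality for `(k, 1, …, 1)`; there are countably many of them. -/
theorem dimH_unitaryWithFoldEigenvalue_add {k : ℕ} (hk : 1 ≤ k) (hkn : k ≤ n) :
    dimH (unitaryWithFoldEigenvalue n k) + ((k ^ 2 - 1 : ℕ) : ENNReal) = dimH (unitarySet n) := by
  apply le_antisymm
  · have hle : ((k ^ 2 - 1 : ℕ) : ENNReal) ≤ dimH (unitarySet n) := by
      rw [dimH_unitarySet]
      exact_mod_cast (Nat.sub_le _ _).trans (Nat.pow_le_pow_left hkn 2)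
    rw [← tsub_add_cancel_of_le hle]
    gcongr
    -- The multiplicities of unitary matrices with a `k`-fold eigenvalue.
    let T : Set (Σ I : ℕ, Fin I → ℕ) :=
      {p | (∀ i, 1 ≤ p.2 i) ∧ ∑ i, p.2 i = n ∧ ∃ i, p.2 i = k}
    have hsub : unitaryWithFoldEigenvalue n k ⊆ ⋃ p ∈ T, unitaryWithMult n p.2 := by
      rintro A ⟨hA, z, hz, hzk⟩
      obtain ⟨I, k', h1, h2, h3⟩ := exists_mem_unitaryWithMult hA
      obtain ⟨ev, -, hs, hm⟩ := h3.2
      rw [hs] at hz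
      obtain ⟨i, rfl⟩ := hz
      exact mem_biUnion (x := (⟨I, k'⟩ : Σ I : ℕ, Fin I → ℕ)) ⟨h1, h2, i, (hm i).symm.trans hzk⟩ h3
    refine (dimH_mono hsub).trans ?_
    rw [dimH_bUnion T.to_countable]
    refine iSup₂_le ?_
    rintro ⟨I, k'⟩ ⟨h1, h2, i, hi⟩
    refine ENNReal.le_sub_of_add_le_right (ENNReal.natCast_ne_top _) ?_
    rw [← dimH_unitaryWithMult_add h1 h2]
    gcongr
    rw [← hi]
    exact Finset.single_le_sum (f := fun i => k' i ^ 2 - 1) (fun _ _ => Nat.zero_le _)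
      (Finset.mem_univ i)
  · rw [← dimH_unitaryWithMult_add (one_le_cons_one hk) (sum_cons_one hkn)]
    have h1 : ∑ i, ((Fin.cons k (fun _ => 1) : Fin (n - k + 1) → ℕ) i ^ 2 - 1) = k ^ 2 - 1 := by
      rw [Fin.sum_univ_succ]
      simp
    rw [h1]
    gcongr
    rintro A ⟨hA, ev, hev, hs, hm⟩
    exact ⟨hA, ev 0, hs ▸ mem_range_self 0, hm 0⟩

end Dimensions

theorem theorem4 (n : ℕ) :
    -- the unitary matrices form a manifold of dimension `n²`
    (IsSubmanifoldOfDim (unitarySet n) ((n : ℤ) ^ 2) ∧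
      dimH (unitarySet n) = ((n ^ 2 : ℕ) : ENNReal)) ∧
    -- the unitary matrices with multiplicities `k 0, …, k (I - 1)`
    (∀ (I : ℕ) (k : Fin I → ℕ), (∀ i, 1 ≤ k i) → ∑ i, k i = n →
      (unitaryWithMult n k).Nonempty ∧
      IsSubmanifoldOfDim (unitaryWithMult n k) ((n : ℤ) ^ 2 - ∑ i, ((k i : ℤ) ^ 2 - 1)) ∧
      IsSubmanifoldOfCodimIn (unitaryWithMult n k) (unitarySet n) (∑ i, ((k i : ℤ) ^ 2 - 1)) ∧
      dimH (unitaryWithMult n k) + ((∑ i, (k i ^ 2 - 1) : ℕ) : ENNReal) = dimH (unitarySet n)) ∧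
    -- a `k`-fold eigenvalue: multiplicities `(k, 1, …, 1)`, and other eigenvalues arbitrary
    (∀ k : ℕ, 1 ≤ k → k ≤ n →
      (unitaryWithMult n (Fin.cons k (fun _ => 1) : Fin (n - k + 1) → ℕ)).Nonempty ∧
      IsSubmanifoldOfCodimIn
        (unitaryWithMult n (Fin.cons k (fun _ => 1) : Fin (n - k + 1) → ℕ)) (unitarySet n)
        ((k : ℤ) ^ 2 - 1) ∧
      dimH (unitaryWithFoldEigenvalue n k) + ((k ^ 2 - 1 : ℕ) : ENNReal)
        = dimH (unitarySet n)) := by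
  refine ⟨⟨by exact_mod_cast isSubmanifoldOfDim_unitarySet n, dimH_unitarySet n⟩,
    fun I k hk hsum => ⟨unitaryWithMult_nonempty hk hsum, isSubmanifoldOfDim_unitaryWithMult,
      isSubmanifoldOfCodimIn_unitaryWithMult, dimH_unitaryWithMult_add hk hsum⟩,
    fun k hk hkn => ⟨unitaryWithMult_nonempty (one_le_cons_one hk) (sum_cons_one hkn), ?_,
      dimH_unitaryWithFoldEigenvalue_add hk hkn⟩⟩
  convert isSubmanifoldOfCodimIn_unitaryWithMult using 1
  rw [Fin.sum_univ_succ]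
  simp
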